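/- Let $V,W$ be finite-dimensional complex vector spaces, $G=\mathrm{GL}(V)$, $H=\mathrm{GL}(W)$, $\mathfrak g=\mathfrak{gl}(V)$, $\mathfrak h=\mathfrak{gl}(W)$, each Lie algebra with the trace form $\langle X,Y\rangle=\mathrm{tr}(XY)$. Let $R\in\mathrm{End}(\mathfrak g)$ and $\rho\in\mathrm{End}(\mathfrak h)$ be r-matrices, i.e. skew-symmetric for the trace form and satisfying $[RX,RY]-R([RX,Y]+[X,RY])+[X,Y]=0$ for all $X,Y$ (likewise for $\rho$). Give $\mathfrak g\oplus\mathfrak g$ the form $\langle\!\langle (X_1,Y_1),(X_2,Y_2)\rangle\!\rangle=\langle X_1,X_2\rangle-\langle Y_1,Y_2\rangle$ and put $\hat R(A,B)=(R(B-A)+B,\,R(B-A)+A)$; do the same for $\mathfrak h\oplus\mathfrak h$ and $\hat\rho$. For a Lie group whose Lie algebra carries such a form, the Sklyanin bracket of a skew endomorphism $r$ is $\{F_1,F_2\}=\langle DF_1,r(DF_2)\rangle-\langle D'F_1,r(D'F_2)\rangle$, where $\frac{d}{dt}\big|_{0}F(e^{tX}ge^{tY})=\langle D_gF,X\rangle+\langle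 D'_gF,Y\rangle$. Let $M=\mathrm{Hom}(W,V)\times\mathrm{Hom}(V,W)$ with points $(v,w)$; identify $T^*_{(v,w)}M$ with pairs $(\xi,x)\in\mathrm{Hom}(W,V)\times\mathrm{Hom}(V,W)$, the pair standing for the differential of the linear function $(v,w)\mapsto\mathrm{tr}(xv+w\xi)$. Let $G\times G$ and $H\times H$ act on $M$ by $(a,b)\cdot(v,w)=(av,wb^{-1})$ and $(p,q)\cdot(v,w)=(vp^{-1},qw)$, with infinitesimal actions $(A,B)_M(v,w)=(Av,-wB)$ and $(P,Q)_M(v,w)=(-vP,Qw)$, and let $G$ and $H$ act through the diagonals: $g\cdot(v,w)=(gv,wg^{-1})$, $h\cdot(v,w)=(vh^{-1},hw)$. Regard $\hat R$ and $\hat\rho$ as 2-tensors by means of $\langle\!\langle\cdot,\cdot\rangle\!\rangle$, let $\hat R_M,\hat\rho_M$ be their images under the infinitesimal actions, let $\Pi((\xi,x),(\eta,y))=\mathrm{tr}(x\eta-y\xi)$, and for $\lambda\in\mathbb C$ put $P_\lambda=\hat R_M+\hat\rho_M+2\lambda\Pi$. All functions are holomorphic. Then for every $\lambda\in\mathbb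 C$: 1. $P_\lambda$ and $\tfrac12P_\lambda$ are Poisson tensors on $M$. For $F(v,w)=\mathrm{tr}(xv+w\xi)$ and $K(v,w)=\mathrm{tr}(yv+w\eta)$, the Poisson bracket $\{\cdot,\cdot\}$ of $\tfrac12P_\lambda$ is $$\begin{aligned}\{F,K\}(v,w)=\tfrac12\Big(&-\mathrm{tr}\big((vx-\xi w)R(vy-\eta w)\big)-\mathrm{tr}\big((xv-w\xi)\rho(yv-w\eta)\big)\\&-\mathrm{tr}\big(wv(y\xi-x\eta)\big)-\mathrm{tr}\big(vw(\xi y-\eta x)\big)+2\lambda\,\mathrm{tr}(x\eta-y\xi)\Big).\end{aligned}$$ The Hamiltonian vector field $\mathbb X_F$ of $F$, defined by $dK(\mathbb X_F)=\{K,F\}$ for all holomorphic $K$, is $$\begin{aligned}\mathbb X_F(v,w)=\tfrac12\Big(&-R(vx-\xi w)v-v\rho(xv-w\xi)+\xi wv+vw\xi+2\lambda\xi,\\&\;wR(vx-\xi w)+\rho(xv-w\xi)w-wvx-xvw-2\lambda x\Big).\end{aligned}$$ 2. The actions of $G$ and $H$ on $(M,P_\lambda)$ are Poisson actions when $G$ and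 $H$ carry the Sklyanin brackets of $-R$ and $-\rho$; the actions on $(M,\tfrac12P_\lambda)$ are Poisson actions when $G$ and $H$ carry the Sklyanin brackets of $-\tfrac12R$ and $-\tfrac12\rho$. 3. For $\lambda=0$, the actions of $G\times G$ and $H\times H$ on $(M,P_0)$ are Poisson actions when these groups carry the Sklyanin brackets of $\hat R$ and $\hat\rho$. Here a Poisson action of a group $K$ with bracket $\{\cdot,\cdot\}_K$ on $M$ means that $K$ is a Poisson Lie group, $M$ a Poisson space, and $\{F_1,F_2\}_M(k\cdot m)=\{F_1(\cdot\,m),F_2(\cdot\,m)\}_K(k)+\{F_1(k\,\cdot),F_2(k\,\cdot)\}_M(m)$ for all holomorphic $F_1,F_2$ on $M$, all $k\in K$ and all $m\in M$. -/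

import Mathlib

open scoped Manifold ContDiff

noncomputable section

namespace PoissonGL

/-! ### Poisson brackets on complex manifolds -/

section Poisson

variable (E : Type*) [NormedAddCommGroup E] [NormedSpace ℂ E]
  {X : Type*} [TopologicalSpace X] [ChartedSpace E X]

/-- Holomorphic (complex analytic) functions on a complex manifold `X` modelled on `E`. -/
def IsHol (F : X → ℂ) : Prop := ContMDiff 𝓘(ℂ, E) 𝓘(ℂ, ℂ) ω F

/-- `br` is a (holomorphic) Poisson bracket on the algebra of holomorphic functions on `X`. Its
values on other functions are irrelevant. -/
structure IsPoissonBracket (br : (X → ℂ) → (X → ℂ) → X → ℂ) : Prop where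
  holo : ∀ F H, IsHol E F → IsHol E H → IsHol E (br F H)
  add : ∀ F₁ F₂ H, IsHol E F₁ → IsHol E F₂ → IsHol E H →
    br (F₁ + F₂) H = br F₁ H + br F₂ H
  smul : ∀ (c : ℂ) F H, IsHol E F → IsHol E H → br (c • F) H = c • br F H
  antisymm : ∀ F H, IsHol E F → IsHol E H → br F H = -br H F
  leibniz : ∀ F₁ F₂ H, IsHol E F₁ → IsHol E F₂ → IsHol E H →
    br (F₁ * F₂) H = F₁ * br F₂ H + br F₁ H * F₂
  jacobi : ∀ F H K, IsHol E F → IsHol E H → IsHol E K →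
    br F (br H K) + br H (br K F) + br K (br F H) = 0

end Poisson

/-! ### Bivectors on a vector space -/

section Bivector

variable {E : Type*} [NormedAddCommGroup E] [NormedSpace ℂ E]

/-- A field of bilinear forms on the cotangent spaces `T*_m E = E*` of the vector space `E`. -/
abbrev CoTensor (E : Type*) [AddCommGroup E] [Module ℂ E] : Type _ :=
  E → LinearMap.BilinForm ℂ (Module.Dual ℂ E)

/-- The differential of `F` at `m`. -/
def diff (F : E → ℂ) (m : E) : Module.Dual ℂ E := (fderiv ℂ F m : E →ₗ[ℂ] ℂ)

/-- The bracket `{F, H}(m) = P(m)(dF, dH)`. -/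
def bracketOf (P : CoTensor E) (F H : E → ℂ) (m : E) : ℂ := P m (diff F m) (diff H m)

/-- `P` is a Poisson tensor: a field of alternating forms (a bivector) whose bracket is Poisson. -/
def IsPoissonTensor (P : CoTensor E) : Prop :=
  (∀ m, (P m).IsAlt) ∧ IsPoissonBracket E (bracketOf P)

end Bivector

/-! ### Invariant inner products and r-matrices on an associative algebra `A`, seen as the Lie
algebra of its group of units -/

/-- A non-degenerate symmetric bilinear form on `A`, invariant for the commutator bracket. -/
structure InvForm (A : Type*) [Ring A] [Algebra ℂ A] where
  form : LinearMap.BilinForm ℂ A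
  nondeg : form.Nondegenerate
  symm : ∀ x y, form x y = form y x
  invariant : ∀ x y z, form ⁅x, y⁆ z = form x ⁅y, z⁆

section Algebra

variable {A : Type*} [Ring A] [Algebra ℂ A]

/-- `R` is a factorizable r-matrix: skew-symmetric, and a solution of the modified classical
Yang-Baxter equation. -/
structure IsRMatrix (κ : InvForm A) (R : A →ₗ[ℂ] A) : Prop where
  skew : ∀ X Y, κ.form (R X) Y = -κ.form X (R Y)
  yangBaxter : ∀ X Y, ⁅R X, R Y⁆ - R (⁅R X, Y⁆ + ⁅X, R Y⁆) + ⁅X, Y⁆ = 0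

/-- The form `⟪(X₁, Y₁), (X₂, Y₂)⟫ = ⟨X₁, X₂⟩ - ⟨Y₁, Y₂⟩` on the double `A × A`. -/
def doubleForm (κ : InvForm A) : InvForm (A × A) where
  form := κ.form.compl₁₂ (LinearMap.fst ℂ A A) (LinearMap.fst ℂ A A) -
    κ.form.compl₁₂ (LinearMap.snd ℂ A A) (LinearMap.snd ℂ A A)
  nondeg := by
    have hs : ∀ p : A × A, (∀ q : A × A, κ.form p.1 q.1 - κ.form p.2 q.2 = 0) → p = 0 := by
      rintro ⟨x, y⟩ h
      refine Prod.ext (κ.nondeg.1 x fun z => ?_) (κ.nondeg.1 y fun z => ?_)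
      · simpa using h (z, 0)
      · simpa using h (0, z)
    refine ⟨fun p h => hs p fun q => by simpa using h q, fun p h => hs p fun q => ?_⟩
    have := h q
    simp only [LinearMap.sub_apply, LinearMap.compl₁₂_apply, LinearMap.fst_apply,
      LinearMap.snd_apply] at this
    rw [κ.symm p.1, κ.symm p.2, this]
  symm p q := by simp [κ.symm p.1, κ.symm p.2]
  invariant p q r := by
    have h1 := κ.invariant p.1 q.1 r.1
    have h2 := κ.invariant p.2 q.2 r.2
    simp only [Ring.lie_def] at h1 h2
    simp [Ring.lie_def, LinearMap.sub_apply] at h1 h2 ⊢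
    rw [h1, h2]

/-- The r-matrix `(X, Y) ↦ (R(Y - X) + Y, R(Y - X) + X)` of the double. -/
def doubleR (R : A →ₗ[ℂ] A) : A × A →ₗ[ℂ] A × A :=
  let p := LinearMap.fst ℂ A A
  let q := LinearMap.snd ℂ A A
  (R ∘ₗ (q - p) + q).prod (R ∘ₗ (q - p) + p)

variable [FiniteDimensional ℂ A]

/-- The identification of `A*` with `A` by means of the inner product. -/
def InvForm.rep (κ : InvForm A) : Module.Dual ℂ A ≃ₗ[ℂ] A :=
  (κ.form.toDual κ.nondeg).symm

theorem InvForm.form_rep (κ : InvForm A) (φ : Module.Dual ℂ A) (X : A) :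
    κ.form (κ.rep φ) X = φ X := by
  rw [← LinearMap.BilinForm.toDual_def κ.nondeg, InvForm.rep, LinearEquiv.apply_symm_apply]

/-- The contravariant 2-tensor on `A*` that corresponds to `r ∈ End(A)`:
`(φ, ψ) ↦ ⟨φ, r ψ⟩`, with `φ` and `ψ` seen in `A`. -/
def InvForm.contract (κ : InvForm A) (r : A →ₗ[ℂ] A) :
    LinearMap.BilinForm ℂ (Module.Dual ℂ A) :=
  κ.form.compl₁₂ (κ.rep : Module.Dual ℂ A →ₗ[ℂ] A) (r ∘ₗ (κ.rep : Module.Dual ℂ A →ₗ[ℂ] A))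

/-- If `r ∈ End(A)` corresponds to the tensor `∑ aᵢ ⊗ bᵢ`, that is `⟨X, r Y⟩ = ∑ ⟨X, aᵢ⟩⟨Y, bᵢ⟩`
for all `X, Y`, then `contract r` is the pairing of `φ ⊗ ψ` with this tensor. -/
theorem InvForm.contract_eq_sum (κ : InvForm A) (r : A →ₗ[ℂ] A) {ι : Type*} [Fintype ι]
    (a b : ι → A) (h : ∀ X Y, κ.form X (r Y) = ∑ i, κ.form X (a i) * κ.form Y (b i))
    (φ ψ : Module.Dual ℂ A) : κ.contract r φ ψ = ∑ i, φ (a i) * ψ (b i) := by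
  simp [InvForm.contract, h, κ.form_rep]

end Algebra

/-! ### Poisson Lie groups `Aˣ` and Poisson actions -/

section Group

variable {A : Type*} [NormedRing A] [NormedAlgebra ℂ A] [CompleteSpace A]

/-- The exponential map `A → Aˣ`. -/
def expUnit (X : A) : Aˣ where
  val := NormedSpace.exp X
  inv := NormedSpace.exp (-X)
  val_inv := by
    let _ : NormedAlgebra ℚ A := NormedAlgebra.restrictScalars ℚ ℂ A
    rw [← NormedSpace.exp_add_of_commute (Commute.neg_right (Commute.refl X))]; simp
  inv_val := by
    let _ : NormedAlgebra ℚ A := NormedAlgebra.restrictScalars ℚ ℂ A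
    rw [← NormedSpace.exp_add_of_commute (Commute.neg_left (Commute.refl X))]; simp

/-- The left derivative: `X ↦ d/dt F(exp(tX) g)` at `t = 0`. -/
def leftD (F : Aˣ → ℂ) (g : Aˣ) : Module.Dual ℂ A := diff (fun X => F (expUnit X * g)) 0

/-- The right derivative: `X ↦ d/dt F(g exp(tX))` at `t = 0`. -/
def rightD (F : Aˣ → ℂ) (g : Aˣ) : Module.Dual ℂ A := diff (fun X => F (g * expUnit X)) 0

/-- The Sklyanin bracket `{F, H} = ⟨DF, r(DH)⟩ - ⟨D'F, r(D'H)⟩` on `Aˣ`. -/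
def sklyanin [FiniteDimensional ℂ A] (κ : InvForm A) (r : A →ₗ[ℂ] A) (F H : Aˣ → ℂ) (g : Aˣ) : ℂ :=
  κ.contract r (leftD F g) (leftD H g) - κ.contract r (rightD F g) (rightD H g)

/-- `Aˣ` with the bracket `br` is a Poisson Lie group. -/
structure IsPoissonLie (br : (Aˣ → ℂ) → (Aˣ → ℂ) → Aˣ → ℂ) : Prop where
  poisson : IsPoissonBracket A br
  multiplicative : ∀ F H : Aˣ → ℂ, IsHol A F → IsHol A H → ∀ g₁ g₂ : Aˣ,
    br F H (g₁ * g₂) =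
      br (fun g => F (g * g₂)) (fun g => H (g * g₂)) g₁ +
      br (fun g => F (g₁ * g)) (fun g => H (g₁ * g)) g₂

/-- `act` is a (holomorphic, left) Poisson action of the Poisson Lie group `(Aˣ, brG)` on the
Poisson space `(E, brM)`. -/
structure IsPoissonAction {E : Type*} [NormedAddCommGroup E] [NormedSpace ℂ E]
    (brG : (Aˣ → ℂ) → (Aˣ → ℂ) → Aˣ → ℂ) (brM : (E → ℂ) → (E → ℂ) → E → ℂ)
    (act : Aˣ → E → E) : Prop where
  poissonLie : IsPoissonLie brG
  poisson : IsPoissonBracket E brM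
  one_act : ∀ m, act 1 m = m
  mul_act : ∀ g h m, act (g * h) m = act g (act h m)
  holo : ContMDiff (𝓘(ℂ, A).prod 𝓘(ℂ, E)) 𝓘(ℂ, E) ω (fun p : Aˣ × E => act p.1 p.2)
  compatible : ∀ F H : E → ℂ, IsHol E F → IsHol E H → ∀ (g : Aˣ) (m : E),
    brM F H (act g m) =
      brG (fun k => F (act k m)) (fun k => H (act k m)) g +
      brM (fun n => F (act g n)) (fun n => H (act g n)) m

end Group

/-! ### The space `M = Hom(W, V) × Hom(V, W)` -/

section Concrete

/-- `End(V)`, both as the algebra `gl(V)` and as the algebra with group of units `GL(V)`. -/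
abbrev gl (V : Type*) [NormedAddCommGroup V] [NormedSpace ℂ V] : Type _ := V →L[ℂ] V

variable (V W : Type*) [NormedAddCommGroup V] [NormedSpace ℂ V] [FiniteDimensional ℂ V]
  [NormedAddCommGroup W] [NormedSpace ℂ W] [FiniteDimensional ℂ W]

instance : CompleteSpace (gl V) :=
  haveI := FiniteDimensional.complete ℂ V
  inferInstance

/-- The trace. -/
def tr : gl V →ₗ[ℂ] ℂ := LinearMap.trace ℂ V ∘ₗ ContinuousLinearMap.coeLM ℂ

variable {V W}

theorem tr_comm (a : W →L[ℂ] V) (b : V →L[ℂ] W) : tr V (a ∘L b) = tr W (b ∘L a) :=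
  LinearMap.trace_comp_comm' (b : V →ₗ[ℂ] W) (a : W →ₗ[ℂ] V)

theorem eq_zero_of_tr (a : W →L[ℂ] V) (h : ∀ b : V →L[ℂ] W, tr W (b ∘L a) = 0) : a = 0 := by
  by_contra hne
  obtain ⟨w, hw⟩ : ∃ w, a w ≠ 0 := by
    by_contra! hc
    exact hne (ContinuousLinearMap.ext hc)
  obtain ⟨f, hf⟩ := SeparatingDual.exists_eq_one (R := ℂ) hw
  have h1 := h (f.smulRight w)
  have h2 : tr W (f.smulRight w ∘L a) = f (a w) :=
    LinearMap.trace_smulRight ((f ∘L a : W →L[ℂ] ℂ) : W →ₗ[ℂ] ℂ) w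
  rw [h2, hf] at h1
  exact one_ne_zero h1

variable (V W)

/-- The trace form `⟨X, Y⟩ = tr(XY)` on `gl(V)`. -/
def traceForm : InvForm (gl V) where
  form := LinearMap.mk₂ ℂ (fun X Y => tr V (X * Y))
    (by intros; simp [add_mul]) (by intros; simp)
    (by intros; simp [mul_add]) (by intros; simp)
  nondeg := ⟨fun X h => eq_zero_of_tr X fun Y => by rw [tr_comm]; exact h Y,
    fun X h => eq_zero_of_tr X fun Y => h Y⟩
  symm X Y := tr_comm X Y
  invariant X Y Z := by
    have h := tr_comm (Y : gl V) (X * Z)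
    simp only [← ContinuousLinearMap.mul_def] at h
    simp only [Ring.lie_def, map_sub, LinearMap.sub_apply,
      LinearMap.mk₂_apply, mul_assoc] at h ⊢
    rw [h]

/-- The space `M = Hom(W, V) × Hom(V, W)` of pairs `(v, w)`. -/
abbrev Mspace : Type _ := (W →L[ℂ] V) × (V →L[ℂ] W)

/-- The pairing `tr(x v + w ξ)` of `(ξ, x)` with `(v, w)`. -/
def pairForm : LinearMap.BilinForm ℂ (Mspace V W) :=
  LinearMap.mk₂ ℂ (fun p m => tr W (p.2 ∘L m.1 + m.2 ∘L p.1))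
    (by intros; simp; ring) (by intros; simp; ring)
    (by intros; simp; ring) (by intros; simp; ring)

/-- The form `tr(x η - y ξ)` of `(ξ, x)` and `(η, y)`. -/
def skewForm : LinearMap.BilinForm ℂ (Mspace V W) :=
  LinearMap.mk₂ ℂ (fun p q => tr W (p.2 ∘L q.1 - q.2 ∘L p.1))
    (by intros; simp; ring) (by intros; simp; ring)
    (by intros; simp; ring) (by intros; simp; ring)

variable {V W}

theorem pairForm_symm (p q : Mspace V W) : pairForm V W p q = pairForm V W q p := by
  simp [pairForm, add_comm]

theorem pairForm_nondeg : (pairForm V W).Nondegenerate := by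
  have hs : ∀ p : Mspace V W, (∀ q, pairForm V W p q = 0) → p = 0 := by
    rintro ⟨ξ, x⟩ h
    refine Prod.ext (eq_zero_of_tr ξ fun b => ?_) (eq_zero_of_tr x fun b => ?_)
    · simpa [pairForm] using h (0, b)
    · rw [tr_comm]
      simpa [pairForm] using h (b, 0)
  exact ⟨hs, fun p h => hs p fun q => by rw [pairForm_symm]; exact h q⟩

variable (V W) in
/-- The identification `T*_m M ≅ {(ξ, x)}`: the pair `(ξ, x)` stands for the covector
`(v, w) ↦ tr(x v + w ξ)`. -/
def cotangent : Module.Dual ℂ (Mspace V W) ≃ₗ[ℂ] Mspace V W :=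
  ((pairForm V W).toDual pairForm_nondeg).symm

/-- The linear function `F(v, w) = tr(x v + w ξ)`. -/
def linFun (ξ : W →L[ℂ] V) (x : V →L[ℂ] W) (m : Mspace V W) : ℂ :=
  tr W (x ∘L m.1 + m.2 ∘L ξ)

/-- The action `g · (v, w) = (g v, w g⁻¹)` of `GL(V)`. -/
def actG (g : (gl V)ˣ) (m : Mspace V W) : Mspace V W :=
  ((g : gl V) ∘L m.1, m.2 ∘L ((g⁻¹ : (gl V)ˣ) : gl V))

/-- The action `h · (v, w) = (v h⁻¹, h w)` of `GL(W)`. -/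
def actH (h : (gl W)ˣ) (m : Mspace V W) : Mspace V W :=
  (m.1 ∘L ((h⁻¹ : (gl W)ˣ) : gl W), (h : gl W) ∘L m.2)

/-- The action `(a, b) · (v, w) = (a v, w b⁻¹)` of the double `GL(V) × GL(V)`, seen as the group of
units of `gl(V) × gl(V)`. -/
def actGG (d : (gl V × gl V)ˣ) (m : Mspace V W) : Mspace V W :=
  ((d : gl V × gl V).1 ∘L m.1, m.2 ∘L ((d⁻¹ : (gl V × gl V)ˣ) : gl V × gl V).2)

/-- The action `(p, q) · (v, w) = (v p⁻¹, q w)` of the double `GL(W) × GL(W)`, seen as the group of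
units of `gl(W) × gl(W)`. -/
def actHH (d : (gl W × gl W)ˣ) (m : Mspace V W) : Mspace V W :=
  (m.1 ∘L ((d⁻¹ : (gl W × gl W)ˣ) : gl W × gl W).1, (d : gl W × gl W).2 ∘L m.2)

/-- The infinitesimal action `(A, B)_M(v, w) = (A v, -w B)` of `gl(V) × gl(V)`. -/
def infGG (m : Mspace V W) : gl V × gl V →ₗ[ℂ] Mspace V W where
  toFun c := (c.1 ∘L m.1, -(m.2 ∘L c.2))
  map_add' c d := by simp [add_comm]
  map_smul' c d := by simp

/-- The infinitesimal action `(P, Q)_M(v, w) = (-v P, Q w)` of `gl(W) × gl(W)`. -/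
def infHH (m : Mspace V W) : gl W × gl W →ₗ[ℂ] Mspace V W where
  toFun c := (-(m.1 ∘L c.1), c.2 ∘L m.2)
  map_add' c d := by simp [add_comm]
  map_smul' c d := by simp

/-- `R̂_M`: the image of the tensor of `R̂` under `(A, B) ↦ (A, B)_M`. -/
def hatR (R : gl V →ₗ[ℂ] gl V) : CoTensor (Mspace V W) := fun m =>
  ((doubleForm (traceForm V)).contract (doubleR R)).compl₁₂ (infGG m).dualMap (infGG m).dualMap

/-- `ρ̂_M`: the image of the tensor of `ρ̂` under `(P, Q) ↦ (P, Q)_M`. -/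
def hatRho (ρ : gl W →ₗ[ℂ] gl W) : CoTensor (Mspace V W) := fun m =>
  ((doubleForm (traceForm W)).contract (doubleR ρ)).compl₁₂ (infHH m).dualMap (infHH m).dualMap

variable (V W) in
/-- The constant bivector `Π((ξ, x), (η, y)) = tr(x η - y ξ)`. -/
def constPi : CoTensor (Mspace V W) := fun _ =>
  (skewForm V W).compl₁₂ (cotangent V W : Module.Dual ℂ (Mspace V W) →ₗ[ℂ] Mspace V W)
    (cotangent V W : Module.Dual ℂ (Mspace V W) →ₗ[ℂ] Mspace V W)

/-- `P_λ = R̂_M + ρ̂_M + 2λΠ`. -/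
def tensorP (R : gl V →ₗ[ℂ] gl V) (ρ : gl W →ₗ[ℂ] gl W) (lam : ℂ) : CoTensor (Mspace V W) :=
  hatR R + hatRho ρ + (2 * lam) • constPi V W

/-- The bracket `{F, H} = P_λ(dF, dH)`. -/
def fullBracket (R : gl V →ₗ[ℂ] gl V) (ρ : gl W →ₗ[ℂ] gl W) (lam : ℂ) :
    (Mspace V W → ℂ) → (Mspace V W → ℂ) → Mspace V W → ℂ :=
  bracketOf (tensorP R ρ lam)

/-- The bracket `{F, H} = ½ P_λ(dF, dH)`. -/
def halfBracket (R : gl V →ₗ[ℂ] gl V) (ρ : gl W →ₗ[ℂ] gl W) (lam : ℂ) :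
    (Mspace V W → ℂ) → (Mspace V W → ℂ) → Mspace V W → ℂ :=
  bracketOf ((1 / 2 : ℂ) • tensorP R ρ lam)

/-- The component in `Hom(W, V)` of the Hamiltonian vector field of `tr(x v + w ξ)`. -/
def hamV (R : gl V →ₗ[ℂ] gl V) (ρ : gl W →ₗ[ℂ] gl W) (lam : ℂ)
    (ξ : W →L[ℂ] V) (x : V →L[ℂ] W) (v : W →L[ℂ] V) (w : V →L[ℂ] W) : W →L[ℂ] V :=
  (1 / 2 : ℂ) • (-(R (v ∘L x - ξ ∘L w) ∘L v) - v ∘L ρ (x ∘L v - w ∘L ξ)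
    + ξ ∘L w ∘L v + v ∘L w ∘L ξ + (2 * lam) • ξ)

/-- The component in `Hom(V, W)` of the Hamiltonian vector field of `tr(x v + w ξ)`. -/
def hamW (R : gl V →ₗ[ℂ] gl V) (ρ : gl W →ₗ[ℂ] gl W) (lam : ℂ)
    (ξ : W →L[ℂ] V) (x : V →L[ℂ] W) (v : W →L[ℂ] V) (w : V →L[ℂ] W) : V →L[ℂ] W :=
  (1 / 2 : ℂ) • (w ∘L R (v ∘L x - ξ ∘L w) + ρ (x ∘L v - w ∘L ξ) ∘L w
    - w ∘L v ∘L x - x ∘L v ∘L w - (2 * lam) • x)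

end Concrete

end PoissonGL

end

/-!
The Poisson property of all brackets comes from one criterion. A field `P` of bivectors on a vector
space with holomorphic coefficients gives a Poisson bracket as soon as its Schouten square vanishes
(`IsPoissonField`): in the Jacobi identity the second derivatives of the functions cancel by
symmetry, and only derivatives of the coefficients of `P` remain. As the identity is proved point by
point, the criterion also covers the group of units of an algebra, an open subset of the algebra
(`IsPoissonField.isPoissonBracket_units`). In particular the Sklyanin bracket of `r` is the
restriction of the quadratic bivector field `sklyaninTensor`.

Both Schouten squares are trace identities. A skew solution `r` of the modified Yang–Baxter equation
with constant `c` satisfies (`IsModRMatrix.form_lie_cyclic`)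
`⟨[rX, rY], Z⟩ + ⟨[rY, rZ], X⟩ + ⟨[rZ, rX], Y⟩ = -c ⟨[X, Y], Z⟩`.
For the Sklyanin bracket the two resulting invariant 3-forms, at left and right translates of the
differentials, agree by cyclicity of the trace. On `Hom(W, V) × Hom(V, W)` the bivector is
`-tr(a R a') - tr(b ρ b')` plus polynomial terms, where `a = v x - ξ w` and `b = x v - w ξ`
(`momV`, `momW`); the invariant 3-forms at `a` and at `b` cancel the contribution of the polynomial
terms.

An action `g · m = S(m, g) + T(m, g⁻¹)` is Poisson when the difference between `P` and the image of
`r` under the infinitesimal action `S - T` is invariant (`isPoissonAction_of_invariant`). For the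
doubles and `λ = 0` this difference is `ρ̂_M` respectively `R̂_M`, which is invariant because the
actions of the two doubles commute. For the diagonals the image of `-R` is `-tr(a R a')`, and each
remaining term of `P_λ` is invariant.
-/

noncomputable section

namespace PoissonGL

/-! ### Poisson tensors on vector spaces -/

section Field

-- Needed for the norm on continuous bilinear forms on the dual.
set_option maxSynthPendingDepth 3

variable {E : Type*} [NormedAddCommGroup E] [NormedSpace ℂ E] [FiniteDimensional ℂ E]

/-- A field of bivectors on a vector space with holomorphic coefficients that satisfies the Jacobi
identity in its tensorial form, the vanishing of the Schouten square. The vectors `u i` are the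
Hamiltonian vectors at `m` of covectors `φ i`, and only derivatives of the coefficients occur. -/
structure IsPoissonField (P : CoTensor E) : Prop where
  alt : ∀ m, (P m).IsAlt
  smooth : ∀ φ ψ, ContDiff ℂ ω fun m => P m φ ψ
  schouten : ∀ (m : E) (φ₁ φ₂ φ₃ : Module.Dual ℂ E) (u₁ u₂ u₃ : E),
    (∀ χ : Module.Dual ℂ E, χ u₁ = P m χ φ₁) → (∀ χ : Module.Dual ℂ E, χ u₂ = P m χ φ₂) →
    (∀ χ : Module.Dual ℂ E, χ u₃ = P m χ φ₃) →
    fderiv ℂ (fun n => P n φ₂ φ₃) m u₁ + fderiv ℂ (fun n => P n φ₃ φ₁) m u₂ +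
      fderiv ℂ (fun n => P n φ₁ φ₂) m u₃ = 0

omit [FiniteDimensional ℂ E] in
theorem IsPoissonField.smul {P : CoTensor E} (h : IsPoissonField P) (c : ℂ) :
    IsPoissonField (c • P) where
  alt m φ := by simp [h.alt m φ]
  smooth φ ψ := by simpa using contDiff_const.mul (h.smooth φ ψ)
  schouten m φ₁ φ₂ φ₃ u₁ u₂ u₃ h₁ h₂ h₃ := by
    have hd (φ ψ) (u : E) :
        fderiv ℂ (fun n => (c • P) n φ ψ) m u = c * fderiv ℂ (fun n => P n φ ψ) m u := by
      have := ((h.smooth φ ψ).differentiable (by simp) m).hasFDerivAt.const_mul c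
      simpa using congrArg (fun L : E →L[ℂ] ℂ => L u) this.fderiv
    obtain rfl | hc := eq_or_ne c 0
    · simp
    have key := h.schouten m φ₁ φ₂ φ₃ (c⁻¹ • u₁) (c⁻¹ • u₂) (c⁻¹ • u₃)
      (fun χ => by simp [h₁, hc]) (fun χ => by simp [h₂, hc]) (fun χ => by simp [h₃, hc])
    simp only [map_smul, smul_eq_mul] at key
    simp only [hd]
    have hcc : c ^ 2 * c⁻¹ = c := by field_simp
    linear_combination c ^ 2 * key + (fderiv ℂ (fun n => P n φ₂ φ₃) m u₁ +
      fderiv ℂ (fun n => P n φ₃ φ₁) m u₂ + fderiv ℂ (fun n => P n φ₁ φ₂) m u₃) * (-hcc)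

/-- A bilinear form on the algebraic dual as a continuous bilinear form on the topological dual. -/
def contBilin : LinearMap.BilinForm ℂ (Module.Dual ℂ E) →
    (E →L[ℂ] ℂ) →L[ℂ] (E →L[ℂ] ℂ) →L[ℂ] ℂ := fun B =>
  (B.compl₁₂ (ContinuousLinearMap.coeLM ℂ : (E →L[ℂ] ℂ) →ₗ[ℂ] E →ₗ[ℂ] ℂ)
    (ContinuousLinearMap.coeLM ℂ)).toContinuousBilinearMap

theorem contBilin_apply (B : LinearMap.BilinForm ℂ (Module.Dual ℂ E)) (φ ψ : E →L[ℂ] ℂ) :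
    contBilin B φ ψ = B (φ : E →ₗ[ℂ] ℂ) (ψ : E →ₗ[ℂ] ℂ) := rfl

theorem IsPoissonField.contDiff_contBilin {P : CoTensor E} (h : IsPoissonField P) :
    ContDiff ℂ ω fun m => contBilin (P m) :=
  contDiff_clm_apply_iff.2 fun _ => contDiff_clm_apply_iff.2 fun _ => h.smooth _ _

theorem IsPoissonField.contDiffAt_bracketOf {P : CoTensor E} (h : IsPoissonField P)
    {F H : E → ℂ} {m : E} (hF : ContDiffAt ℂ ω F m) (hH : ContDiffAt ℂ ω H m) :
    ContDiffAt ℂ ω (bracketOf P F H) m :=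
  (h.contDiff_contBilin.contDiffAt.clm_apply (hF.fderiv_right (by simp))).clm_apply
    (hH.fderiv_right (by simp))

/-- The derivative of a bracket: one term from the coefficients, two from the second derivatives
of the functions. -/
theorem IsPoissonField.fderiv_bracketOf {P : CoTensor E} (h : IsPoissonField P)
    {F H : E → ℂ} {m : E} (hF : ContDiffAt ℂ ω F m) (hH : ContDiffAt ℂ ω H m) (u : E) :
    fderiv ℂ (bracketOf P F H) m u =
      fderiv ℂ (fun n => P n (diff F m) (diff H m)) m u +
      P m (fderiv ℂ (fderiv ℂ F) m u : E →L[ℂ] ℂ) (diff H m) +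
      P m (diff F m) (fderiv ℂ (fderiv ℂ H) m u : E →L[ℂ] ℂ) := by
  have hP := (h.contDiff_contBilin.differentiable (by simp) m).hasFDerivAt
  have hF' := ((hF.fderiv_right (m := ω) (by simp)).differentiableAt (by simp)).hasFDerivAt
  have hH' := ((hH.fderiv_right (m := ω) (by simp)).differentiableAt (by simp)).hasFDerivAt
  have hc := (hP.clm_apply (hasFDerivAt_const (fderiv ℂ F m) m)).clm_apply
    (hasFDerivAt_const (fderiv ℂ H m) m)
  have ha := (hP.clm_apply hF').clm_apply hH'
  have e1 : fderiv ℂ (bracketOf P F H) m u = _ := congrArg (fun L : E →L[ℂ] ℂ => L u) ha.fderiv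
  have e2 : fderiv ℂ (fun n => P n (diff F m) (diff H m)) m u = _ :=
    congrArg (fun L : E →L[ℂ] ℂ => L u) hc.fderiv
  rw [e1, e2]
  simp [contBilin_apply, diff]
  ring

omit [FiniteDimensional ℂ E] in
theorem IsPoissonField.swap {P : CoTensor E} (h : IsPoissonField P) (m : E)
    (φ ψ : Module.Dual ℂ E) : P m φ ψ = -P m ψ φ := by
  rw [(h.alt m).neg_eq]

/-- The Jacobi identity. The second derivatives cancel because they are symmetric, and what is left
is the Schouten square. -/
theorem IsPoissonField.jacobi {P : CoTensor E} (h : IsPoissonField P)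
    {F H K : E → ℂ} {m : E} (hF : ContDiffAt ℂ ω F m) (hH : ContDiffAt ℂ ω H m)
    (hK : ContDiffAt ℂ ω K m) :
    bracketOf P F (bracketOf P H K) m + bracketOf P H (bracketOf P K F) m +
      bracketOf P K (bracketOf P F H) m = 0 := by
  have hs (φ : Module.Dual ℂ E) : ∃ u : E, ∀ χ : Module.Dual ℂ E, χ u = P m χ φ :=
    ⟨(Module.evalEquiv ℂ E).symm ((P m).flip φ), fun χ => by simp⟩
  obtain ⟨u₁, h₁⟩ := hs (diff F m)
  obtain ⟨u₂, h₂⟩ := hs (diff H m)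
  obtain ⟨u₃, h₃⟩ := hs (diff K m)
  have key := h.schouten m _ _ _ u₁ u₂ u₃ h₁ h₂ h₃
  have b1 : bracketOf P F (bracketOf P H K) m = -fderiv ℂ (bracketOf P H K) m u₁ := by
    rw [bracketOf, h.swap, ← h₁]; rfl
  have b2 : bracketOf P H (bracketOf P K F) m = -fderiv ℂ (bracketOf P K F) m u₂ := by
    rw [bracketOf, h.swap, ← h₂]; rfl
  have b3 : bracketOf P K (bracketOf P F H) m = -fderiv ℂ (bracketOf P F H) m u₃ := by
    rw [bracketOf, h.swap, ← h₃]; rfl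
  rw [b1, b2, b3, h.fderiv_bracketOf hH hK, h.fderiv_bracketOf hK hF, h.fderiv_bracketOf hF hH,
    h.swap m (diff H m), h.swap m (diff K m), h.swap m (diff F m)]
  simp only [← h₁, ← h₂, ← h₃]
  have sF := (hF.isSymmSndFDerivAt (by simp)) u₂ u₃
  have sH := (hH.isSymmSndFDerivAt (by simp)) u₁ u₃
  have sK := (hK.isSymmSndFDerivAt (by simp)) u₁ u₂
  simp only [ContinuousLinearMap.coe_coe]
  linear_combination -key + sF - sH + sK

omit [FiniteDimensional ℂ E] in
theorem diff_add {F H : E → ℂ} {m : E} (hF : ContDiffAt ℂ ω F m) (hH : ContDiffAt ℂ ω H m) :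
    diff (F + H) m = diff F m + diff H m := by
  have := fderiv_add (hF.differentiableAt (by simp)) (hH.differentiableAt (by simp))
  ext u
  simp [diff, this]

omit [FiniteDimensional ℂ E] in
theorem diff_smul (c : ℂ) {F : E → ℂ} {m : E} (hF : ContDiffAt ℂ ω F m) :
    diff (c • F) m = c • diff F m := by
  have := fderiv_const_smul (hF.differentiableAt (by simp)) c
  ext u
  simp [diff, this]

omit [FiniteDimensional ℂ E] in
theorem diff_mul {F H : E → ℂ} {m : E} (hF : ContDiffAt ℂ ω F m) (hH : ContDiffAt ℂ ω H m) :
    diff (F * H) m = F m • diff H m + H m • diff F m := by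
  have := fderiv_mul (hF.differentiableAt (by simp)) (hH.differentiableAt (by simp))
  ext u
  simp [diff, this]

theorem IsPoissonField.isPoissonTensor {P : CoTensor E} (h : IsPoissonField P) :
    IsPoissonTensor P := by
  have hol {F : E → ℂ} (hF : IsHol E F) (m : E) : ContDiffAt ℂ ω F m :=
    (contMDiff_iff_contDiff.1 hF).contDiffAt
  refine ⟨h.alt, ?_, ?_, ?_, ?_, ?_, ?_⟩
  · exact fun F H hF hH => contMDiff_iff_contDiff.2 <| contDiff_iff_contDiffAt.2 fun m =>
      h.contDiffAt_bracketOf (hol hF m) (hol hH m)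
  · intro F₁ F₂ H h₁ h₂ _
    ext m
    simp [bracketOf, diff_add (hol h₁ m) (hol h₂ m)]
  · intro c F H hF _
    ext m
    simp [bracketOf, diff_smul c (hol hF m)]
  · intro F H _ _
    ext m
    exact h.swap m _ _
  · intro F₁ F₂ H h₁ h₂ _
    ext m
    simp [bracketOf, diff_mul (hol h₁ m) (hol h₂ m), mul_comm]
  · intro F H K hF hH hK
    ext m
    exact h.jacobi (hol hF m) (hol hH m) (hol hK m)

omit [FiniteDimensional ℂ E] in
/-- The derivative of a function whose restriction to a line is quadratic. -/
theorem fderiv_of_quadratic {f : E → ℂ} (hf : ContDiff ℂ ω f) {m u : E} {L Q : ℂ}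
    (h : ∀ t : ℂ, f (m + t • u) = f m + t * L + t ^ 2 * Q) : fderiv ℂ f m u = L := by
  have h1 := (hf.differentiable (by simp) m).hasFDerivAt.hasLineDerivAt u
  have h2 : HasDerivAt (fun t : ℂ => f m + t * L + t ^ 2 * Q) L 0 := by
    have := (((hasDerivAt_id (0 : ℂ)).mul_const L).const_add (f m)).add
      (((hasDerivAt_id (0 : ℂ)).pow 2).mul_const Q)
    refine HasDerivAt.congr_deriv this (by simp)
  rw [HasLineDerivAt, funext h] at h1
  exact h1.unique h2

end Field

/-! ### Poisson brackets on groups of units -/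

section Units

variable {A : Type*} [NormedRing A] [NormedAlgebra ℂ A] [CompleteSpace A]

/-- The extension of a function on `Aˣ` to `A`; only its values on the open set of units matter. -/
def unitsExt (F : Aˣ → ℂ) : A → ℂ :=
  F ∘ (Units.isOpenEmbedding_val.toOpenPartialHomeomorph (Units.val : Aˣ → A)).symm

omit [NormedAlgebra ℂ A] in
@[simp]
theorem unitsExt_val (F : Aˣ → ℂ) (g : Aˣ) : unitsExt F (g : A) = F g :=
  congrArg F <| (Units.isOpenEmbedding_val.toOpenPartialHomeomorph
    (Units.val : Aˣ → A)).left_inv (Set.mem_univ g)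

omit [NormedAlgebra ℂ A] in
theorem unitsExt_eventuallyEq {F : Aˣ → ℂ} {f : A → ℂ} (h : ∀ g : Aˣ, F g = f g) (g : Aˣ) :
    unitsExt F =ᶠ[nhds (g : A)] f := by
  filter_upwards [Units.nhds g] with a ⟨k, hk⟩
  rw [← hk, unitsExt_val, h]

theorem isHol_units_iff {F : Aˣ → ℂ} :
    IsHol A F ↔ ∀ g : Aˣ, ContDiffAt ℂ ω (unitsExt F) (g : A) := by
  constructor
  · intro hF g
    have h := contMDiffOn_isOpenEmbedding_symm (I := 𝓘(ℂ, A)) (n := ω)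
      (Units.isOpenEmbedding_val (R := A))
    have h1 := (hF.comp_contMDiffOn h).contMDiffAt
      ((Units.isOpenEmbedding_val (R := A)).isOpen_range.mem_nhds ⟨g, rfl⟩)
    exact contMDiffAt_iff_contDiffAt.1 h1
  · intro h g
    have h1 := (contMDiffAt_iff_contDiffAt.2 (h g)).comp g (Units.contMDiff_val (𝕜 := ℂ) (n := ω) g)
    exact h1.congr_of_eventuallyEq (Filter.Eventually.of_forall fun k => (unitsExt_val F k).symm)

/-- A Poisson bivector field on `A` restricts to a Poisson bracket on the open set of units. -/
theorem IsPoissonField.isPoissonBracket_units [FiniteDimensional ℂ A] {P : CoTensor A}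
    (h : IsPoissonField P) {br : (Aˣ → ℂ) → (Aˣ → ℂ) → Aˣ → ℂ}
    (hbr : ∀ F H, IsHol A F → IsHol A H → ∀ g : Aˣ,
      br F H g = bracketOf P (unitsExt F) (unitsExt H) g) :
    IsPoissonBracket A br := by
  have ho (F H) (hF : IsHol A F) (hH : IsHol A H) : IsHol A (br F H) :=
    isHol_units_iff.2 fun g =>
      (h.contDiffAt_bracketOf (isHol_units_iff.1 hF g)
        (isHol_units_iff.1 hH g)).congr_of_eventuallyEq (unitsExt_eventuallyEq (hbr F H hF hH) g)
  have hd {F : Aˣ → ℂ} {f : A → ℂ} (g : Aˣ) (h : ∀ k : Aˣ, F k = f k) :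
      diff (unitsExt F) (g : A) = diff f g := by
    rw [diff, diff, (unitsExt_eventuallyEq h g).fderiv_eq]
  refine ⟨ho, ?_, ?_, ?_, ?_, ?_⟩
  · intro F₁ F₂ H h₁ h₂ hH
    ext g
    have e : diff (unitsExt (F₁ + F₂)) (g : A) = diff (unitsExt F₁ + unitsExt F₂) g :=
      hd g fun k => by simp
    rw [Pi.add_apply, hbr _ _ (h₁.add h₂) hH, hbr _ _ h₁ hH, hbr _ _ h₂ hH, bracketOf, e,
      diff_add (isHol_units_iff.1 h₁ g) (isHol_units_iff.1 h₂ g)]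
    simp [bracketOf]
  · intro c F H hF hH
    ext g
    have e : diff (unitsExt (c • F)) (g : A) = diff (c • unitsExt F) g := hd g fun k => by simp
    have hc : IsHol A (c • F) := (contMDiff_const (c := c)).mul hF
    rw [Pi.smul_apply, hbr _ _ hc hH, hbr _ _ hF hH, bracketOf, e,
      diff_smul c (isHol_units_iff.1 hF g)]
    simp [bracketOf]
  · intro F H hF hH
    ext g
    rw [Pi.neg_apply, hbr _ _ hF hH, hbr _ _ hH hF]
    exact h.swap _ _ _
  · intro F₁ F₂ H h₁ h₂ hH
    ext g
    have e : diff (unitsExt (F₁ * F₂)) (g : A) = diff (unitsExt F₁ * unitsExt F₂) g :=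
      hd g fun k => by simp
    rw [Pi.add_apply, Pi.mul_apply, Pi.mul_apply, hbr _ _ (h₁.mul h₂) hH, hbr _ _ h₁ hH,
      hbr _ _ h₂ hH, bracketOf, e, diff_mul (isHol_units_iff.1 h₁ g) (isHol_units_iff.1 h₂ g)]
    simp [bracketOf, mul_comm]
  · intro F H K hF hH hK
    ext g
    have e {F H K} (hF : IsHol A F) (hH : IsHol A H) (hK : IsHol A K) : br F (br H K) g =
        bracketOf P (unitsExt F) (bracketOf P (unitsExt H) (unitsExt K)) g := by
      rw [hbr _ _ hF (ho _ _ hH hK), bracketOf, hd g (hbr _ _ hH hK), bracketOf]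
    simp only [Pi.add_apply, e hF hH hK, e hH hK hF, e hK hF hH]
    exact h.jacobi (isHol_units_iff.1 hF g) (isHol_units_iff.1 hH g) (isHol_units_iff.1 hK g)

theorem hasFDerivAt_expUnit : HasFDerivAt (fun X : A => (expUnit X : A)) (1 : A →L[ℂ] A) 0 :=
  hasFDerivAt_exp_zero

@[simp] theorem expUnit_zero : expUnit (0 : A) = 1 := Units.ext NormedSpace.exp_zero

theorem diff_comp_apply {E E' : Type*} [NormedAddCommGroup E] [NormedSpace ℂ E]
    [NormedAddCommGroup E'] [NormedSpace ℂ E'] {f : E' → ℂ} {γ : E → E'} {x : E}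
    {L : E →L[ℂ] E'} (hf : ContDiffAt ℂ ω f (γ x)) (hγ : HasFDerivAt γ L x) :
    diff (fun y => f (γ y)) x = diff f (γ x) ∘ₗ (L : E →ₗ[ℂ] E') := by
  have := ((hf.differentiableAt (by simp)).hasFDerivAt.comp x hγ).fderiv
  ext u
  exact congrArg (fun M : E →L[ℂ] ℂ => M u) this

theorem leftD_eq {F : Aˣ → ℂ} (hF : IsHol A F) (g : Aˣ) :
    leftD F g = diff (unitsExt F) g ∘ₗ LinearMap.mulRight ℂ (g : A) := by
  have h1 : HasFDerivAt (fun X : A => (expUnit X : A) * g)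
      ((ContinuousLinearMap.mul ℂ A).flip (g : A)) 0 :=
    (((ContinuousLinearMap.mul ℂ A).flip (g : A)).hasFDerivAt.comp 0 hasFDerivAt_expUnit :)
  have h2 := diff_comp_apply (f := unitsExt F) (by simpa using isHol_units_iff.1 hF g) h1
  have h3 : leftD F g = diff (fun X : A => unitsExt F ((expUnit X : A) * g)) 0 := by
    simp [leftD, ← Units.val_mul]
  rw [h3, h2]
  ext X
  simp

theorem rightD_eq {F : Aˣ → ℂ} (hF : IsHol A F) (g : Aˣ) :
    rightD F g = diff (unitsExt F) g ∘ₗ LinearMap.mulLeft ℂ (g : A) := by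
  have h1 : HasFDerivAt (fun X : A => (g : A) * (expUnit X : A))
      (ContinuousLinearMap.mul ℂ A (g : A)) 0 :=
    ((ContinuousLinearMap.mul ℂ A (g : A)).hasFDerivAt.comp 0 hasFDerivAt_expUnit :)
  have h2 := diff_comp_apply (f := unitsExt F) (by simpa using isHol_units_iff.1 hF g) h1
  have h3 : rightD F g = diff (fun X : A => unitsExt F ((g : A) * (expUnit X : A))) 0 := by
    simp [rightD, ← Units.val_mul]
  rw [h3, h2]
  ext X
  simp

end Units

/-! ### Sklyanin brackets -/

section Sklyanin

theorem contDiff_bilin {E F : Type*} [NormedAddCommGroup E] [NormedSpace ℂ E]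
    [NormedAddCommGroup F] [NormedSpace ℂ F] [FiniteDimensional ℂ F]
    (B : LinearMap.BilinForm ℂ F) {f g : E → F} (hf : ContDiff ℂ ω f) (hg : ContDiff ℂ ω g) :
    ContDiff ℂ ω fun m => B (f m) (g m) :=
  (B.toContinuousBilinearMap.contDiff.comp hf).clm_apply hg

theorem contDiff_linearMap_comp {E F G : Type*} [NormedAddCommGroup E] [NormedSpace ℂ E]
    [NormedAddCommGroup F] [NormedSpace ℂ F] [FiniteDimensional ℂ F] [NormedAddCommGroup G]
    [NormedSpace ℂ G] (r : F →ₗ[ℂ] G) {f : E → F} (hf : ContDiff ℂ ω f) :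
    ContDiff ℂ ω fun m => r (f m) :=
  r.toContinuousLinearMap.contDiff.comp hf

/-- The modified classical Yang–Baxter equation with constant `c`, for a skew endomorphism. The
constant makes the class of solutions stable under rescaling. -/
structure IsModRMatrix {A : Type*} [Ring A] [Algebra ℂ A] (κ : InvForm A) (c : ℂ)
    (r : A →ₗ[ℂ] A) : Prop where
  skew : ∀ X Y, κ.form (r X) Y = -κ.form X (r Y)
  yangBaxter : ∀ X Y, ⁅r X, r Y⁆ - r (⁅r X, Y⁆ + ⁅X, r Y⁆) + c • ⁅X, Y⁆ = 0

section Algebra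

variable {A : Type*} [Ring A] [Algebra ℂ A] {κ : InvForm A} {c : ℂ} {r : A →ₗ[ℂ] A}

theorem IsRMatrix.isMod (h : IsRMatrix κ r) : IsModRMatrix κ 1 r :=
  ⟨h.skew, fun X Y => by simpa using h.yangBaxter X Y⟩

theorem IsModRMatrix.smul (h : IsModRMatrix κ c r) (a : ℂ) :
    IsModRMatrix κ (a ^ 2 * c) (a • r) where
  skew X Y := by simp [h.skew]
  yangBaxter X Y := by
    have := congrArg (fun Z => a ^ 2 • Z) (h.yangBaxter X Y)
    simp only [smul_zero] at this
    rw [← this]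
    simp only [LinearMap.smul_apply, Ring.lie_def, map_add, map_sub, smul_mul_assoc,
      mul_smul_comm, map_smul]
    module

theorem IsModRMatrix.form_apply_right (h : IsModRMatrix κ c r) (X Y : A) :
    κ.form X (r Y) = -κ.form Y (r X) := by
  rw [← neg_eq_iff_eq_neg, ← h.skew, κ.symm]

/-- The invariant 3-form `κ([X, Y], Z)` is, up to the constant, the Schouten square of `r`. -/
theorem IsModRMatrix.form_lie_cyclic (h : IsModRMatrix κ c r) (X Y Z : A) :
    κ.form ⁅r X, r Y⁆ Z + κ.form ⁅r Y, r Z⁆ X + κ.form ⁅r Z, r X⁆ Y =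
      -(c * κ.form ⁅X, Y⁆ Z) := by
  have h1 := congrArg (fun T => κ.form T Z) (h.yangBaxter X Y)
  simp only [map_add, map_sub, LinearMap.add_apply, LinearMap.sub_apply, h.skew, map_smul,
    LinearMap.smul_apply, map_zero, LinearMap.zero_apply, smul_eq_mul] at h1
  rw [κ.invariant X, κ.symm X, κ.symm _ (r Z), ← κ.invariant] at h1
  linear_combination h1

/-- The double of a solution of the modified Yang–Baxter equation solves it as well. -/
theorem IsRMatrix.double (h : IsRMatrix κ r) : IsModRMatrix (doubleForm κ) 1 (doubleR r) where
  skew X Y := by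
    have h1 := h.skew
    simp [doubleForm, doubleR, h1]
    ring
  yangBaxter X Y := by
    obtain ⟨A, B⟩ := X
    obtain ⟨A', B'⟩ := Y
    have h1 := h.yangBaxter (B - A) (B' - A')
    simp only [Ring.lie_def, map_add, map_sub] at h1
    ext
    · simp [doubleR, Ring.lie_def]
      rw [← h1]
      simp [mul_add, add_mul, mul_sub, sub_mul]
      abel
    · simp [doubleR, Ring.lie_def]
      rw [← h1]
      simp [mul_add, add_mul, mul_sub, sub_mul]
      abel

theorem form_ext {x y : A} (h : ∀ z, κ.form z x = κ.form z y) : x = y :=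
  sub_eq_zero.1 <| κ.nondeg.2 _ fun z => by simp [h]

theorem rep_eq_of_form [FiniteDimensional ℂ A] {φ : Module.Dual ℂ A} {x : A}
    (h : ∀ y, φ y = κ.form x y) : κ.rep φ = x :=
  sub_eq_zero.1 <| κ.nondeg.1 _ fun y => by simp [κ.form_rep, h]

theorem contract_of_rep_eq [FiniteDimensional ℂ A] (r : A →ₗ[ℂ] A) {φ ψ : Module.Dual ℂ A}
    {x y : A} (hx : κ.rep φ = x) (hy : κ.rep ψ = y) : κ.contract r φ ψ = κ.form x (r y) := by
  subst hx hy
  rfl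

theorem doubleForm_doubleR (κ : InvForm A) (r : A →ₗ[ℂ] A) (x₁ x₂ y₁ y₂ : A) :
    (doubleForm κ).form (x₁, x₂) (doubleR r (y₁, y₂)) =
      -κ.form (x₂ - x₁) (r (y₂ - y₁)) + κ.form x₁ y₂ - κ.form x₂ y₁ := by
  simp [doubleForm, doubleR]
  ring

/-- The contravariant tensor of `r` transported by a linear map `f` from the Lie algebra. -/
def pushTensor [FiniteDimensional ℂ A] {E : Type*} [AddCommGroup E] [Module ℂ E]
    (κ : InvForm A) (r : A →ₗ[ℂ] A) (f : A →ₗ[ℂ] E) : LinearMap.BilinForm ℂ (Module.Dual ℂ E) :=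
  (κ.contract r).compl₁₂ f.dualMap f.dualMap

end Algebra

variable {A : Type*} [NormedRing A] [NormedAlgebra ℂ A] [FiniteDimensional ℂ A]
  {κ : InvForm A} {c : ℂ} {r : A →ₗ[ℂ] A}

/-- The bivector field on `A`, quadratic in `g`, whose restriction to the units gives the Sklyanin
bracket. -/
def sklyaninTensor (κ : InvForm A) (r : A →ₗ[ℂ] A) : CoTensor A := fun g =>
  (κ.contract r).compl₁₂ (LinearMap.mulRight ℂ g).dualMap (LinearMap.mulRight ℂ g).dualMap -
  (κ.contract r).compl₁₂ (LinearMap.mulLeft ℂ g).dualMap (LinearMap.mulLeft ℂ g).dualMap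

theorem sklyaninTensor_apply (hκ : ∀ x y z, κ.form (x * y) z = κ.form x (y * z)) (g : A)
    (φ ψ : Module.Dual ℂ A) :
    sklyaninTensor κ r g φ ψ =
      κ.form (g * κ.rep φ) (r (g * κ.rep ψ)) - κ.form (κ.rep φ * g) (r (κ.rep ψ * g)) := by
  have h1 (φ : Module.Dual ℂ A) : κ.rep ((LinearMap.mulRight ℂ g).dualMap φ) = g * κ.rep φ :=
    rep_eq_of_form fun y => by
      rw [κ.symm, ← hκ, κ.symm, κ.form_rep]
      rfl
  have h2 (φ : Module.Dual ℂ A) : κ.rep ((LinearMap.mulLeft ℂ g).dualMap φ) = κ.rep φ * g :=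
    rep_eq_of_form fun y => by
      rw [hκ, κ.form_rep]
      rfl
  simp [sklyaninTensor, InvForm.contract, h1, h2]

/-- In the Schouten square the terms that mix left and right translates of `r` cancel, and the two
pure parts reduce to the invariant 3-form at `g pᵢ` and at `pᵢ g`, where its values agree. -/
theorem isPoissonField_sklyaninTensor (hκ : ∀ x y z, κ.form (x * y) z = κ.form x (y * z))
    (hr : IsModRMatrix κ c r) : IsPoissonField (sklyaninTensor κ r) where
  alt g φ := by
    have h (x : A) : κ.form x (r x) = 0 := by
      have := hr.form_apply_right x x
      exact self_eq_neg.1 this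
    simp [sklyaninTensor_apply hκ, h]
  smooth φ ψ := by
    simp only [sklyaninTensor_apply hκ]
    exact (contDiff_bilin _ (by fun_prop) (contDiff_linearMap_comp r (by fun_prop))).sub
      (contDiff_bilin _ (by fun_prop) (contDiff_linearMap_comp r (by fun_prop)))
  schouten g φ₁ φ₂ φ₃ u₁ u₂ u₃ h₁ h₂ h₃ := by
    have hu (φ : Module.Dual ℂ A) (u : A)
        (h : ∀ χ : Module.Dual ℂ A, χ u = sklyaninTensor κ r g χ φ) :
        u = r (g * κ.rep φ) * g - g * r (κ.rep φ * g) := by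
      refine form_ext (κ := κ) fun z => ?_
      have hz : κ.rep (κ.form z) = z := rep_eq_of_form fun y => rfl
      rw [h (κ.form z), sklyaninTensor_apply hκ, hz, map_sub, ← hκ z g, κ.symm (g * z), ← hκ,
        κ.symm _ z]
    have hL (φ ψ : Module.Dual ℂ A) (u : A) :
        fderiv ℂ (fun n => sklyaninTensor κ r n φ ψ) g u =
          κ.form (u * κ.rep φ) (r (g * κ.rep ψ)) - κ.form (u * κ.rep ψ) (r (g * κ.rep φ)) -
            κ.form (κ.rep φ * u) (r (κ.rep ψ * g)) + κ.form (κ.rep ψ * u) (r (κ.rep φ * g)) := by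
      refine fderiv_of_quadratic (Q := sklyaninTensor κ r u φ ψ) ?_ fun t => ?_
      · simp only [sklyaninTensor_apply hκ]
        exact (contDiff_bilin _ (by fun_prop) (contDiff_linearMap_comp r (by fun_prop))).sub
          (contDiff_bilin _ (by fun_prop) (contDiff_linearMap_comp r (by fun_prop)))
      · rw [hr.form_apply_right (u * κ.rep ψ), hr.form_apply_right (κ.rep ψ * u)]
        simp only [sklyaninTensor_apply hκ, add_mul, mul_add, map_add, LinearMap.add_apply,
          smul_mul_assoc, mul_smul_comm, map_smul, LinearMap.smul_apply, smul_eq_mul]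
        ring
    have k1 := hr.form_lie_cyclic (g * κ.rep φ₁) (g * κ.rep φ₂) (g * κ.rep φ₃)
    have k2 := hr.form_lie_cyclic (κ.rep φ₁ * g) (κ.rep φ₂ * g) (κ.rep φ₃ * g)
    rw [hL, hL, hL, hu _ _ h₁, hu _ _ h₂, hu _ _ h₃]
    obtain ⟨τ, hτ⟩ : ∃ τ : A →ₗ[ℂ] ℂ, ∀ x y, κ.form x y = τ (x * y) :=
      ⟨κ.form.flip 1, fun x y => by simp [hκ]⟩
    have hc (x y : A) : τ (x * y) = τ (y * x) := by rw [← hτ, ← hτ, κ.symm]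
    simp only [hτ] at k1 k2 ⊢
    generalize r (g * κ.rep φ₁) = a₁, r (g * κ.rep φ₂) = a₂, r (g * κ.rep φ₃) = a₃,
      r (κ.rep φ₁ * g) = b₁, r (κ.rep φ₂ * g) = b₂, r (κ.rep φ₃ * g) = b₃ at k1 k2 ⊢
    generalize κ.rep φ₁ = p₁, κ.rep φ₂ = p₂, κ.rep φ₃ = p₃ at k1 k2 ⊢
    -- Every word contains one letter with index 1; cyclicity moves it to the front.
    simp only [Ring.lie_def, sub_mul, mul_sub, mul_assoc, map_sub, hc g, hc a₂, hc a₃, hc b₂,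
      hc b₃, hc p₂, hc p₃] at k1 k2 ⊢
    linear_combination k1 - k2

theorem sklyanin_eq_bracketOf [CompleteSpace A] {F H : Aˣ → ℂ} (hF : IsHol A F) (hH : IsHol A H)
    (g : Aˣ) :
    sklyanin κ r F H g = bracketOf (sklyaninTensor κ r) (unitsExt F) (unitsExt H) g := by
  rw [sklyanin, leftD_eq hF, leftD_eq hH, rightD_eq hF, rightD_eq hH]
  rfl

theorem isPoissonLie_sklyanin [CompleteSpace A]
    (hκ : ∀ x y z, κ.form (x * y) z = κ.form x (y * z)) (hr : IsModRMatrix κ c r) :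
    IsPoissonLie (sklyanin κ r) where
  poisson := (isPoissonField_sklyaninTensor hκ hr).isPoissonBracket_units fun _ _ hF hH g =>
    sklyanin_eq_bracketOf hF hH g
  multiplicative F H _ _ g₁ g₂ := by
    simp only [sklyanin, leftD, rightD, mul_assoc]
    ring

/-- A criterion for Poisson actions of the form `g · m = S(m, g) + T(m, g⁻¹)` with `S` and `T`
bilinear: the difference between the bivector field `P` and the image of `r` under the
infinitesimal action `S - T` has to be invariant. -/
theorem isPoissonAction_of_invariant [CompleteSpace A] {E : Type*} [NormedAddCommGroup E]
    [NormedSpace ℂ E] [FiniteDimensional ℂ E]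
    (hκ : ∀ x y z, κ.form (x * y) z = κ.form x (y * z)) (hr : IsModRMatrix κ c r)
    {P : CoTensor E} (hP : IsPoissonField P) (S T : E →ₗ[ℂ] A →ₗ[ℂ] E) {act : Aˣ → E → E}
    (hact : ∀ g m, act g m = S m (g : A) + T m ((g⁻¹ : Aˣ) : A)) (one_act : ∀ m, act 1 m = m)
    (mul_act : ∀ g h m, act (g * h) m = act g (act h m))
    (hinv : ∀ (g : Aˣ) (l : E →ₗ[ℂ] E), (∀ m, l m = act g m) → ∀ m φ ψ,
      P (act g m) φ ψ - pushTensor κ r (S (act g m) - T (act g m)) φ ψ =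
        P m (φ ∘ₗ l) (ψ ∘ₗ l) - pushTensor κ r (S m - T m) (φ ∘ₗ l) (ψ ∘ₗ l)) :
    IsPoissonAction (sklyanin κ r) (bracketOf P) act where
  poissonLie := isPoissonLie_sklyanin hκ hr
  poisson := hP.isPoissonTensor.2
  one_act := one_act
  mul_act := mul_act
  holo := by
    have h1 : ContMDiff (𝓘(ℂ, A).prod 𝓘(ℂ, E)) 𝓘(ℂ, A) ω (fun p : Aˣ × E => (p.1 : A)) :=
      Units.contMDiff_val.comp contMDiff_fst
    have h2 : ContMDiff (𝓘(ℂ, A).prod 𝓘(ℂ, E)) 𝓘(ℂ, A) ω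
        (fun p : Aˣ × E => ((p.1⁻¹ : Aˣ) : A)) :=
      Units.contMDiff_val.comp ((contMDiff_inv 𝓘(ℂ, A) ω).comp contMDiff_fst)
    have hc (B : E →ₗ[ℂ] A →ₗ[ℂ] E) : ContMDiff (𝓘(ℂ, A).prod 𝓘(ℂ, E)) 𝓘(ℂ, A →L[ℂ] E) ω
        (fun p : Aˣ × E => B.toContinuousBilinearMap p.2) :=
      (contMDiff_iff_contDiff.2 B.toContinuousBilinearMap.contDiff).comp contMDiff_snd
    simp only [hact]
    exact ((hc S).clm_apply h1).add ((hc T).clm_apply h2)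
  compatible F H hF hH g m := by
    let l (g : Aˣ) : E →ₗ[ℂ] E := S.flip (g : A) + T.flip ((g⁻¹ : Aˣ) : A)
    have hl (g m) : l g m = act g m := by simp [l, hact]
    have hF' {F : E → ℂ} (hF : IsHol E F) (x : E) : ContDiffAt ℂ ω F x :=
      (contMDiff_iff_contDiff.1 hF).contDiffAt
    have dact (g : Aˣ) (m : E) : HasFDerivAt (act g) (l g).toContinuousLinearMap m := by
      have := (l g).toContinuousLinearMap.hasFDerivAt (x := m)
      exact this.congr_of_eventuallyEq (Filter.Eventually.of_forall fun x => (hl g x).symm)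
    have dF {F : E → ℂ} (hF : IsHol E F) (g : Aˣ) (m : E) :
        diff (fun n => F (act g n)) m = diff F (act g m) ∘ₗ l g :=
      diff_comp_apply (hF' hF _) (dact g m)
    have dexp (m : E) : HasFDerivAt (fun X : A => act (expUnit X) m)
        (S m - T m).toContinuousLinearMap 0 := by
      have e1 := (S m).toContinuousLinearMap.hasFDerivAt.comp (0 : A) hasFDerivAt_expUnit
      have e2 := (T m).toContinuousLinearMap.hasFDerivAt.comp (0 : A)
        (HasFDerivAt.comp (0 : A) (f := fun X : A => -X) (by simpa using hasFDerivAt_expUnit)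
          ((hasFDerivAt_id (0 : A)).neg))
      refine ((e1.add e2).congr_of_eventuallyEq
        (Filter.Eventually.of_forall fun X => ?_)).congr_fderiv ?_
      · simp only [hact]
        rfl
      · ext X
        simp [sub_eq_add_neg]
    have left {F : E → ℂ} (hF : IsHol E F) :
        leftD (fun k => F (act k m)) g = diff F (act g m) ∘ₗ (S (act g m) - T (act g m)) := by
      have := diff_comp_apply (by simpa [one_act] using hF' hF (act g m)) (dexp (act g m))
      simpa [leftD, mul_act, one_act] using this
    have right {F : E → ℂ} (hF : IsHol E F) :
        rightD (fun k => F (act k m)) g = diff F (act g m) ∘ₗ l g ∘ₗ (S m - T m) := by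
      have := diff_comp_apply (f := F) (by simpa [one_act] using hF' hF _)
        ((dact g (act (expUnit 0) m)).comp (0 : A) (dexp m))
      simpa [rightD, mul_act, one_act, LinearMap.comp_sub] using this
    have key := hinv g (l g) (hl g) m (diff F (act g m)) (diff H (act g m))
    rw [sklyanin, left hF, left hH, right hF, right hH, bracketOf, bracketOf, dF hF, dF hH]
    simp only [pushTensor, LinearMap.compl₁₂_apply] at key
    exact (sub_eq_iff_eq_add.1 key).trans (by
      simp only [LinearMap.dualMap_apply', LinearMap.comp_assoc]; ring)

end Sklyanin

/-! ### The bivector on `Hom(W, V) × Hom(V, W)` -/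

section Space

variable {V W : Type*} [NormedAddCommGroup V] [NormedSpace ℂ V] [FiniteDimensional ℂ V]
  [NormedAddCommGroup W] [NormedSpace ℂ W] [FiniteDimensional ℂ W]

theorem traceForm_apply (X Y : gl V) : (traceForm V).form X Y = tr V (X ∘L Y) := rfl

theorem traceForm_assoc (x y z : gl V) :
    (traceForm V).form (x * y) z = (traceForm V).form x (y * z) := by
  simp [traceForm, mul_assoc]

theorem doubleForm_assoc {A : Type*} [Ring A] [Algebra ℂ A] {κ : InvForm A}
    (hκ : ∀ x y z, κ.form (x * y) z = κ.form x (y * z)) (x y z : A × A) :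
    (doubleForm κ).form (x * y) z = (doubleForm κ).form x (y * z) := by
  simp [doubleForm, hκ]

theorem pairForm_cotangent (φ : Module.Dual ℂ (Mspace V W)) (m : Mspace V W) :
    pairForm V W (cotangent V W φ) m = φ m := by
  rw [← LinearMap.BilinForm.toDual_def pairForm_nondeg, cotangent, LinearEquiv.apply_symm_apply]

theorem apply_eq_tr (φ : Module.Dual ℂ (Mspace V W)) (m : Mspace V W) :
    φ m = tr W ((cotangent V W φ).2 ∘L m.1) + tr W (m.2 ∘L (cotangent V W φ).1) := by
  rw [← pairForm_cotangent]
  simp [pairForm]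

theorem cotangent_eq {φ : Module.Dual ℂ (Mspace V W)} {p : Mspace V W}
    (h : ∀ m, φ m = tr W (p.2 ∘L m.1) + tr W (m.2 ∘L p.1)) : cotangent V W φ = p :=
  sub_eq_zero.1 <| pairForm_nondeg.1 _ fun m => by
    rw [map_sub, LinearMap.sub_apply, pairForm_cotangent, h]
    simp [pairForm]

/-- The component `v x - ξ w` in `gl(V)` of the moment map of the cotangent lift. -/
def momV (m p : Mspace V W) : gl V := m.1 ∘L p.2 - p.1 ∘L m.2

/-- The component `x v - w ξ` in `gl(W)` of the moment map of the cotangent lift. -/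
def momW (m p : Mspace V W) : gl W := p.2 ∘L m.1 - m.2 ∘L p.1

theorem hatR_apply (R : gl V →ₗ[ℂ] gl V) (m : Mspace V W) (φ ψ : Module.Dual ℂ (Mspace V W)) :
    hatR R m φ ψ = -tr V (momV m (cotangent V W φ) ∘L R (momV m (cotangent V W ψ))) +
      tr V (m.1 ∘L (cotangent V W φ).2 ∘L (cotangent V W ψ).1 ∘L m.2) -
      tr V ((cotangent V W φ).1 ∘L m.2 ∘L m.1 ∘L (cotangent V W ψ).2) := by
  have h (φ : Module.Dual ℂ (Mspace V W)) :
      (doubleForm (traceForm V)).rep ((infGG m).dualMap φ) =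
        (m.1 ∘L (cotangent V W φ).2, (cotangent V W φ).1 ∘L m.2) := by
    refine rep_eq_of_form fun y => ?_
    rw [LinearMap.dualMap_apply, apply_eq_tr]
    simp [infGG, doubleForm, traceForm_apply, ContinuousLinearMap.comp_assoc,
      tr_comm m.1, tr_comm (cotangent V W φ).1, sub_eq_add_neg]
  refine (contract_of_rep_eq (doubleR R) (h φ) (h ψ)).trans ?_
  have e (p : Mspace V W) : p.1 ∘L m.2 - m.1 ∘L p.2 = -momV m p := (neg_sub _ _).symm
  rw [doubleForm_doubleR]
  simp only [e, map_neg, LinearMap.neg_apply, neg_neg]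
  rfl

theorem hatRho_apply (ρ : gl W →ₗ[ℂ] gl W) (m : Mspace V W)
    (φ ψ : Module.Dual ℂ (Mspace V W)) :
    hatRho ρ m φ ψ = -tr W (momW m (cotangent V W φ) ∘L ρ (momW m (cotangent V W ψ))) +
      tr W ((cotangent V W φ).2 ∘L m.1 ∘L m.2 ∘L (cotangent V W ψ).1) -
      tr W (m.2 ∘L (cotangent V W φ).1 ∘L (cotangent V W ψ).2 ∘L m.1) := by
  have h (φ : Module.Dual ℂ (Mspace V W)) :
      (doubleForm (traceForm W)).rep ((infHH m).dualMap φ) =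
        (-((cotangent V W φ).2 ∘L m.1), -(m.2 ∘L (cotangent V W φ).1)) := by
    refine rep_eq_of_form fun y => ?_
    rw [LinearMap.dualMap_apply, apply_eq_tr]
    have := tr_comm (m.2 ∘L (cotangent V W φ).1) y.2
    simp [infHH, doubleForm, traceForm_apply, ContinuousLinearMap.comp_assoc] at this ⊢
    simp [this]
  refine (contract_of_rep_eq (doubleR ρ) (h φ) (h ψ)).trans ?_
  rw [doubleForm_doubleR]
  simp only [neg_sub_neg, map_neg, LinearMap.neg_apply, neg_neg]
  rfl

theorem constPi_apply (m : Mspace V W) (φ ψ : Module.Dual ℂ (Mspace V W)) :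
    constPi V W m φ ψ = tr W ((cotangent V W φ).2 ∘L (cotangent V W ψ).1) -
      tr W ((cotangent V W ψ).2 ∘L (cotangent V W φ).1) := by
  simp [constPi, skewForm]

variable (R : gl V →ₗ[ℂ] gl V) (ρ : gl W →ₗ[ℂ] gl W) (lam : ℂ)

theorem tensorP_apply (m : Mspace V W) (φ ψ : Module.Dual ℂ (Mspace V W)) :
    tensorP R ρ lam m φ ψ = hatR R m φ ψ + hatRho ρ m φ ψ + 2 * lam * constPi V W m φ ψ := by
  simp [tensorP]

theorem cotangent_diff_linFun (ξ : W →L[ℂ] V) (x : V →L[ℂ] W) (m : Mspace V W) :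
    cotangent V W (diff (linFun ξ x) m) = (ξ, x) := by
  have h : linFun ξ x = (pairForm V W (ξ, x)).toContinuousLinearMap := by
    ext m
    simp [linFun, pairForm]
  refine cotangent_eq fun n => ?_
  rw [h, diff, ContinuousLinearMap.fderiv]
  simp [pairForm]

theorem halfBracket_linFun (ξ η : W →L[ℂ] V) (x y : V →L[ℂ] W) (v : W →L[ℂ] V)
    (w : V →L[ℂ] W) :
    halfBracket R ρ lam (linFun ξ x) (linFun η y) (v, w) =
      (1 / 2 : ℂ) *
        (-tr V ((v ∘L x - ξ ∘L w) ∘L R (v ∘L y - η ∘L w))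
          - tr W ((x ∘L v - w ∘L ξ) ∘L ρ (y ∘L v - w ∘L η))
          - tr W ((w ∘L v) ∘L (y ∘L ξ - x ∘L η))
          - tr V ((v ∘L w) ∘L (ξ ∘L y - η ∘L x))
          + 2 * lam * tr W (x ∘L η - y ∘L ξ)) := by
  simp only [halfBracket, bracketOf, Pi.smul_apply, LinearMap.smul_apply, smul_eq_mul,
    tensorP_apply, hatR_apply, hatRho_apply, constPi_apply, cotangent_diff_linFun, momV, momW]
  simp only [ContinuousLinearMap.comp_sub, ContinuousLinearMap.comp_assoc, map_sub,
    tr_comm v, tr_comm w, tr_comm ξ, tr_comm η]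
  ring

/-- The Hamiltonian vector of a covector with components `(ξ, x)`. -/
theorem half_tensorP_eq (m : Mspace V W) (χ φ : Module.Dual ℂ (Mspace V W)) :
    ((1 / 2 : ℂ) • tensorP R ρ lam) m χ φ =
      χ (hamV R ρ lam (cotangent V W φ).1 (cotangent V W φ).2 m.1 m.2,
        hamW R ρ lam (cotangent V W φ).1 (cotangent V W φ).2 m.1 m.2) := by
  rw [apply_eq_tr]
  simp only [Pi.smul_apply, LinearMap.smul_apply, smul_eq_mul,
    tensorP_apply, hatR_apply, hatRho_apply, constPi_apply, momV, momW, hamV, hamW]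
  obtain ⟨v, w⟩ := m
  obtain ⟨ξ, x⟩ := cotangent V W φ
  obtain ⟨η, y⟩ := cotangent V W χ
  generalize R _ = a
  generalize ρ _ = b
  simp only [ContinuousLinearMap.comp_sub, ContinuousLinearMap.sub_comp,
    ContinuousLinearMap.comp_add, ContinuousLinearMap.add_comp, ContinuousLinearMap.comp_assoc,
    map_sub, map_add, map_neg,
    ContinuousLinearMap.comp_neg, ContinuousLinearMap.comp_smul,
    ContinuousLinearMap.smul_comp, map_smul, smul_eq_mul,
    tr_comm v, tr_comm w, tr_comm x, tr_comm a, tr_comm b]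
  ring

/-- The derivative of the coefficients along `u`. Since `R` and `ρ` are skew, only the moment maps
have to be differentiated. -/
theorem fderiv_half_tensorP (hR : IsRMatrix (traceForm V) R) (hρ : IsRMatrix (traceForm W) ρ)
    (m u : Mspace V W) (φ ψ : Module.Dual ℂ (Mspace V W)) :
    ContDiff ℂ ω (fun n => ((1 / 2 : ℂ) • tensorP R ρ lam) n φ ψ) ∧
    fderiv ℂ (fun n => ((1 / 2 : ℂ) • tensorP R ρ lam) n φ ψ) m u = (1 / 2 : ℂ) *
      (-tr V (momV u (cotangent V W φ) ∘L R (momV m (cotangent V W ψ)))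
        + tr V (momV u (cotangent V W ψ) ∘L R (momV m (cotangent V W φ)))
        - tr W (momW u (cotangent V W φ) ∘L ρ (momW m (cotangent V W ψ)))
        + tr W (momW u (cotangent V W ψ) ∘L ρ (momW m (cotangent V W φ)))
        + tr V (m.1 ∘L (cotangent V W φ).2 ∘L (cotangent V W ψ).1 ∘L u.2)
        + tr V (u.1 ∘L (cotangent V W φ).2 ∘L (cotangent V W ψ).1 ∘L m.2)
        - tr V ((cotangent V W φ).1 ∘L m.2 ∘L u.1 ∘L (cotangent V W ψ).2)
        - tr V ((cotangent V W φ).1 ∘L u.2 ∘L m.1 ∘L (cotangent V W ψ).2)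
        + tr W ((cotangent V W φ).2 ∘L m.1 ∘L u.2 ∘L (cotangent V W ψ).1)
        + tr W ((cotangent V W φ).2 ∘L u.1 ∘L m.2 ∘L (cotangent V W ψ).1)
        - tr W (m.2 ∘L (cotangent V W φ).1 ∘L (cotangent V W ψ).2 ∘L u.1)
        - tr W (u.2 ∘L (cotangent V W φ).1 ∘L (cotangent V W ψ).2 ∘L m.1)) := by
  have hs : ContDiff ℂ ω (fun n => ((1 / 2 : ℂ) • tensorP R ρ lam) n φ ψ) := by
    simp only [Pi.smul_apply, LinearMap.smul_apply, smul_eq_mul, tensorP_apply, hatR_apply,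
      hatRho_apply, constPi_apply, momV, momW]
    refine contDiff_const.mul (((((ContDiff.neg ?_).add ?_).sub ?_).add
      (((ContDiff.neg ?_).add ?_).sub ?_)).add contDiff_const) <;>
    refine contDiff_linearMap_comp _ ?_
    · exact ContDiff.clm_comp (by fun_prop) (contDiff_linearMap_comp _ (by fun_prop))
    · fun_prop
    · fun_prop
    · exact ContDiff.clm_comp (by fun_prop) (contDiff_linearMap_comp _ (by fun_prop))
    · fun_prop
    · fun_prop
  refine ⟨hs, fderiv_of_quadratic hs
    (Q := ((1 / 2 : ℂ) • tensorP R ρ 0) u φ ψ) fun t => ?_⟩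
  have h1 := hR.isMod.form_apply_right (momV u (cotangent V W ψ)) (momV m (cotangent V W φ))
  have h2 := hρ.isMod.form_apply_right (momW u (cotangent V W ψ)) (momW m (cotangent V W φ))
  rw [traceForm_apply, traceForm_apply] at h1 h2
  rw [h1, h2]
  have e1 (p : Mspace V W) : momV (m + t • u) p = momV m p + t • momV u p := by
    simp [momV, smul_sub]
    abel
  have e2 (p : Mspace V W) : momW (m + t • u) p = momW m p + t • momW u p := by
    simp [momW, smul_sub]
    abel
  simp only [Pi.smul_apply, LinearMap.smul_apply, smul_eq_mul,
    tensorP_apply, hatR_apply, hatRho_apply, constPi_apply, e1, e2]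
  simp only [Prod.fst_add, Prod.snd_add, Prod.smul_fst, Prod.smul_snd, map_add, map_smul,
    ContinuousLinearMap.comp_add, ContinuousLinearMap.add_comp, ContinuousLinearMap.comp_smul,
    ContinuousLinearMap.smul_comp, smul_eq_mul, smul_add]
  ring

-- The expanded trace identity has more than a hundred words.
set_option maxHeartbeats 2000000 in
/-- The Schouten square vanishes: the terms of degree two in `R` and in `ρ` reduce to the invariant
3-forms of `gl(V)` and `gl(W)` at the moment maps, which cancel the terms without `R` and `ρ`. -/
theorem isPoissonField_half_tensorP (hR : IsRMatrix (traceForm V) R)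
    (hρ : IsRMatrix (traceForm W) ρ) : IsPoissonField ((1 / 2 : ℂ) • tensorP R ρ lam) where
  alt m φ := by
    have h1 := hR.isMod.form_apply_right (momV m (cotangent V W φ)) (momV m (cotangent V W φ))
    have h2 := hρ.isMod.form_apply_right (momW m (cotangent V W φ)) (momW m (cotangent V W φ))
    rw [traceForm_apply] at h1 h2
    simp only [Pi.smul_apply, LinearMap.smul_apply, smul_eq_mul,
      tensorP_apply, hatR_apply, hatRho_apply, constPi_apply, self_eq_neg.1 h1, self_eq_neg.1 h2,
      tr_comm m.1, tr_comm (cotangent V W φ).1, tr_comm m.2, ContinuousLinearMap.comp_assoc]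
    ring
  smooth φ ψ := (fderiv_half_tensorP R ρ lam hR hρ 0 0 φ ψ).1
  schouten m φ₁ φ₂ φ₃ u₁ u₂ u₃ h₁ h₂ h₃ := by
    have hu (φ : Module.Dual ℂ (Mspace V W)) (u : Mspace V W)
        (h : ∀ χ : Module.Dual ℂ (Mspace V W), χ u = ((1 / 2 : ℂ) • tensorP R ρ lam) m χ φ) :
        u = (hamV R ρ lam (cotangent V W φ).1 (cotangent V W φ).2 m.1 m.2,
          hamW R ρ lam (cotangent V W φ).1 (cotangent V W φ).2 m.1 m.2) :=
      (Module.forall_dual_apply_eq_zero_iff ℂ _).1 (fun χ => by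
        rw [map_sub, h, half_tensorP_eq, sub_self]) |> sub_eq_zero.1
    rw [(fderiv_half_tensorP R ρ lam hR hρ m _ _ _).2,
      (fderiv_half_tensorP R ρ lam hR hρ m _ _ _).2, (fderiv_half_tensorP R ρ lam hR hρ m _ _ _).2,
      hu _ _ h₁, hu _ _ h₂, hu _ _ h₃]
    generalize cotangent V W φ₁ = p₁, cotangent V W φ₂ = p₂, cotangent V W φ₃ = p₃
    have k1 := hR.isMod.form_lie_cyclic (momV m p₁) (momV m p₂) (momV m p₃)
    have k2 := hρ.isMod.form_lie_cyclic (momW m p₁) (momW m p₂) (momW m p₃)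
    simp only [traceForm_apply, Ring.lie_def, ContinuousLinearMap.mul_def] at k1 k2
    obtain ⟨v, w⟩ := m
    obtain ⟨ξ₁, x₁⟩ := p₁
    obtain ⟨ξ₂, x₂⟩ := p₂
    obtain ⟨ξ₃, x₃⟩ := p₃
    simp only [hamV, hamW, momV, momW] at k1 k2 ⊢
    generalize R (v ∘L x₁ - ξ₁ ∘L w) = a₁, R (v ∘L x₂ - ξ₂ ∘L w) = a₂,
      R (v ∘L x₃ - ξ₃ ∘L w) = a₃, ρ (x₁ ∘L v - w ∘L ξ₁) = b₁, ρ (x₂ ∘L v - w ∘L ξ₂) = b₂,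
      ρ (x₃ ∘L v - w ∘L ξ₃) = b₃ at k1 k2 ⊢
    -- Every word contains one letter with index 1; cyclicity moves it to the front.
    simp only [ContinuousLinearMap.comp_sub, ContinuousLinearMap.sub_comp,
      ContinuousLinearMap.comp_add, ContinuousLinearMap.add_comp, ContinuousLinearMap.comp_assoc,
      map_sub, map_add, map_neg, ContinuousLinearMap.comp_neg, ContinuousLinearMap.neg_comp,
      ContinuousLinearMap.comp_smul, ContinuousLinearMap.smul_comp, map_smul, smul_eq_mul,
      tr_comm v, tr_comm w, tr_comm ξ₂, tr_comm ξ₃, tr_comm x₂, tr_comm x₃, tr_comm a₂,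
      tr_comm a₃, tr_comm b₂, tr_comm b₃] at k1 k2 ⊢
    linear_combination (1 / 4 : ℂ) * k1 - (1 / 4 : ℂ) * k2

end Space

/-! ### Invariance and the Poisson actions -/

section Actions

variable {V W : Type*} [NormedAddCommGroup V] [NormedSpace ℂ V] [FiniteDimensional ℂ V]
  [NormedAddCommGroup W] [NormedSpace ℂ W] [FiniteDimensional ℂ W]

variable (V W) in
/-- The action of the first factor of `GL(V) × GL(V)`, extended bilinearly. -/
def leftGG : Mspace V W →ₗ[ℂ] (gl V × gl V) →ₗ[ℂ] Mspace V W :=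
  LinearMap.mk₂ ℂ (fun m d => (d.1 ∘L m.1, 0)) (by intros; simp) (by intros; simp)
    (by intros; simp) (by intros; simp)

variable (V W) in
/-- The action of the inverse of the second factor of `GL(V) × GL(V)`, extended bilinearly. -/
def rightGG : Mspace V W →ₗ[ℂ] (gl V × gl V) →ₗ[ℂ] Mspace V W :=
  LinearMap.mk₂ ℂ (fun m d => (0, m.2 ∘L d.2)) (by intros; simp) (by intros; simp)
    (by intros; simp) (by intros; simp)

variable (V W) in
/-- The action of the second factor of `GL(W) × GL(W)`, extended bilinearly. -/
def leftHH : Mspace V W →ₗ[ℂ] (gl W × gl W) →ₗ[ℂ] Mspace V W :=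
  LinearMap.mk₂ ℂ (fun m d => (0, d.2 ∘L m.2)) (by intros; simp) (by intros; simp)
    (by intros; simp) (by intros; simp)

variable (V W) in
/-- The action of the inverse of the first factor of `GL(W) × GL(W)`, extended bilinearly. -/
def rightHH : Mspace V W →ₗ[ℂ] (gl W × gl W) →ₗ[ℂ] Mspace V W :=
  LinearMap.mk₂ ℂ (fun m d => (m.1 ∘L d.1, 0)) (by intros; simp) (by intros; simp)
    (by intros; simp) (by intros; simp)

omit [FiniteDimensional ℂ V] [FiniteDimensional ℂ W] in
@[simp] theorem leftGG_apply (m : Mspace V W) (d : gl V × gl V) :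
    leftGG V W m d = (d.1 ∘L m.1, 0) := rfl

omit [FiniteDimensional ℂ V] [FiniteDimensional ℂ W] in
@[simp] theorem rightGG_apply (m : Mspace V W) (d : gl V × gl V) :
    rightGG V W m d = (0, m.2 ∘L d.2) := rfl

omit [FiniteDimensional ℂ V] [FiniteDimensional ℂ W] in
@[simp] theorem leftHH_apply (m : Mspace V W) (d : gl W × gl W) :
    leftHH V W m d = (0, d.2 ∘L m.2) := rfl

omit [FiniteDimensional ℂ V] [FiniteDimensional ℂ W] in
@[simp] theorem rightHH_apply (m : Mspace V W) (d : gl W × gl W) :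
    rightHH V W m d = (m.1 ∘L d.1, 0) := rfl

/-- The diagonal of `A × A`. -/
def diagonal (A : Type*) [AddCommGroup A] [Module ℂ A] : A →ₗ[ℂ] A × A :=
  LinearMap.prod LinearMap.id LinearMap.id

omit [FiniteDimensional ℂ V] [FiniteDimensional ℂ W] in
theorem leftGG_sub_rightGG (m : Mspace V W) : leftGG V W m - rightGG V W m = infGG m := by
  refine LinearMap.ext fun d => ?_
  simp [infGG]

omit [FiniteDimensional ℂ V] [FiniteDimensional ℂ W] in
theorem leftHH_sub_rightHH (m : Mspace V W) : leftHH V W m - rightHH V W m = infHH m := by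
  refine LinearMap.ext fun d => ?_
  simp [infHH]

omit [FiniteDimensional ℂ W] in
/-- `R̂_M` is preserved by every linear map that intertwines the infinitesimal action of
`gl(V) × gl(V)` at two points. -/
theorem hatR_of_commute (R : gl V →ₗ[ℂ] gl V) {m m' : Mspace V W}
    {l : Mspace V W →ₗ[ℂ] Mspace V W} (h : ∀ c, l (infGG m c) = infGG m' c)
    (φ ψ : Module.Dual ℂ (Mspace V W)) : hatR R m (φ ∘ₗ l) (ψ ∘ₗ l) = hatR R m' φ ψ := by
  have e (φ : Module.Dual ℂ (Mspace V W)) :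
      (infGG m).dualMap (φ ∘ₗ l) = (infGG m').dualMap φ :=
    LinearMap.ext fun c => congrArg φ (h c)
  simp only [hatR, LinearMap.compl₁₂_apply, e]

omit [FiniteDimensional ℂ V] in
/-- `ρ̂_M` is preserved by every linear map that intertwines the infinitesimal action of
`gl(W) × gl(W)` at two points. -/
theorem hatRho_of_commute (ρ : gl W →ₗ[ℂ] gl W) {m m' : Mspace V W}
    {l : Mspace V W →ₗ[ℂ] Mspace V W} (h : ∀ c, l (infHH m c) = infHH m' c)
    (φ ψ : Module.Dual ℂ (Mspace V W)) : hatRho ρ m (φ ∘ₗ l) (ψ ∘ₗ l) = hatRho ρ m' φ ψ := by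
  have e (φ : Module.Dual ℂ (Mspace V W)) :
      (infHH m).dualMap (φ ∘ₗ l) = (infHH m').dualMap φ :=
    LinearMap.ext fun c => congrArg φ (h c)
  simp only [hatRho, LinearMap.compl₁₂_apply, e]

theorem pushTensor_diagonal_infGG (r : gl V →ₗ[ℂ] gl V) (m : Mspace V W)
    (φ ψ : Module.Dual ℂ (Mspace V W)) :
    pushTensor (traceForm V) r (infGG m ∘ₗ diagonal (gl V)) φ ψ =
      tr V (momV m (cotangent V W φ) ∘L r (momV m (cotangent V W ψ))) := by
  have h (φ : Module.Dual ℂ (Mspace V W)) :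
      (traceForm V).rep ((infGG m ∘ₗ diagonal (gl V)).dualMap φ) = momV m (cotangent V W φ) := by
    refine rep_eq_of_form fun y => ?_
    rw [LinearMap.dualMap_apply, apply_eq_tr]
    simp [infGG, diagonal, momV, traceForm_apply, ContinuousLinearMap.comp_assoc,
      tr_comm m.1, tr_comm (cotangent V W φ).1, sub_eq_add_neg]
  exact contract_of_rep_eq r (h φ) (h ψ)

theorem pushTensor_diagonal_infHH (r : gl W →ₗ[ℂ] gl W) (m : Mspace V W)
    (φ ψ : Module.Dual ℂ (Mspace V W)) :
    pushTensor (traceForm W) r (infHH m ∘ₗ diagonal (gl W)) φ ψ =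
      tr W (momW m (cotangent V W φ) ∘L r (momW m (cotangent V W ψ))) := by
  have h (φ : Module.Dual ℂ (Mspace V W)) :
      (traceForm W).rep ((infHH m ∘ₗ diagonal (gl W)).dualMap φ) =
        -momW m (cotangent V W φ) := by
    refine rep_eq_of_form fun y => ?_
    rw [LinearMap.dualMap_apply, apply_eq_tr]
    have := tr_comm (m.2 ∘L (cotangent V W φ).1) y
    simp [infHH, diagonal, momW, traceForm_apply, ContinuousLinearMap.comp_assoc] at this ⊢
    rw [this]
    ring
  refine (contract_of_rep_eq r (h φ) (h ψ)).trans ?_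
  simp only [map_neg, LinearMap.neg_apply, neg_neg]
  rfl

omit [FiniteDimensional ℂ V] in
theorem inv_comp_comp {U : Type*} [NormedAddCommGroup U] [NormedSpace ℂ U] (g : (gl V)ˣ)
    (z : U →L[ℂ] V) : ((g⁻¹ : (gl V)ˣ) : gl V) ∘L (g : gl V) ∘L z = z :=
  ContinuousLinearMap.ext fun u => congrArg (fun a : gl V => a (z u)) g.inv_mul

omit [FiniteDimensional ℂ V] in
theorem comp_inv_comp {U : Type*} [NormedAddCommGroup U] [NormedSpace ℂ U] (g : (gl V)ˣ)
    (z : U →L[ℂ] V) : (g : gl V) ∘L ((g⁻¹ : (gl V)ˣ) : gl V) ∘L z = z :=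
  ContinuousLinearMap.ext fun u => congrArg (fun a : gl V => a (z u)) g.mul_inv

variable (R : gl V →ₗ[ℂ] gl V) (ρ : gl W →ₗ[ℂ] gl W) (lam : ℂ)

theorem isPoissonField_tensorP (hR : IsRMatrix (traceForm V) R)
    (hρ : IsRMatrix (traceForm W) ρ) : IsPoissonField (tensorP R ρ lam) := by
  simpa [smul_smul] using (isPoissonField_half_tensorP R ρ lam hR hρ).smul 2

theorem isPoissonAction_actGG (hR : IsRMatrix (traceForm V) R) (hρ : IsRMatrix (traceForm W) ρ) :
    IsPoissonAction (E := Mspace V W) (A := gl V × gl V)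
      (sklyanin (A := gl V × gl V) (doubleForm (traceForm V)) (doubleR R))
      (fullBracket R ρ 0) (actGG (V := V) (W := W)) := by
  refine isPoissonAction_of_invariant (A := gl V × gl V)
    (doubleForm_assoc (traceForm_assoc (V := V))) hR.double
    (isPoissonField_tensorP R ρ 0 hR hρ) (leftGG V W) (rightGG V W) ?_ ?_ ?_ ?_
  · intro g m
    simp [actGG]
  · intro m
    refine Prod.ext ?_ ?_ <;> ext <;> simp [actGG]
  · intro g h m
    refine Prod.ext ?_ ?_ <;> ext <;> simp [actGG]
  · intro g l hl m φ ψ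
    have h (m : Mspace V W) (φ ψ : Module.Dual ℂ (Mspace V W)) :
        tensorP R ρ 0 m φ ψ - pushTensor (doubleForm (traceForm V)) (doubleR R)
          (leftGG V W m - rightGG V W m) φ ψ = hatRho ρ m φ ψ := by
      rw [leftGG_sub_rightGG, tensorP_apply]
      change hatR R m φ ψ + _ + _ - hatR R m φ ψ = _
      ring
    rw [h, h]
    refine (hatRho_of_commute ρ (fun c => ?_) φ ψ).symm
    rw [hl]
    refine Prod.ext ?_ ?_ <;> ext <;> simp [actGG, infHH]

theorem isPoissonAction_actHH (hR : IsRMatrix (traceForm V) R) (hρ : IsRMatrix (traceForm W) ρ) :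
    IsPoissonAction (E := Mspace V W) (A := gl W × gl W)
      (sklyanin (A := gl W × gl W) (doubleForm (traceForm W)) (doubleR ρ))
      (fullBracket R ρ 0) (actHH (V := V) (W := W)) := by
  refine isPoissonAction_of_invariant (A := gl W × gl W)
    (doubleForm_assoc (traceForm_assoc (V := W))) hρ.double
    (isPoissonField_tensorP R ρ 0 hR hρ) (leftHH V W) (rightHH V W) ?_ ?_ ?_ ?_
  · intro g m
    simp [actHH]
  · intro m
    refine Prod.ext ?_ ?_ <;> ext <;> simp [actHH]
  · intro g h m
    refine Prod.ext ?_ ?_ <;> ext <;> simp [actHH]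
  · intro g l hl m φ ψ
    have h (m : Mspace V W) (φ ψ : Module.Dual ℂ (Mspace V W)) :
        tensorP R ρ 0 m φ ψ - pushTensor (doubleForm (traceForm W)) (doubleR ρ)
          (leftHH V W m - rightHH V W m) φ ψ = hatR R m φ ψ := by
      rw [leftHH_sub_rightHH, tensorP_apply]
      change _ + hatRho ρ m φ ψ + _ - hatRho ρ m φ ψ = _
      ring
    rw [h, h]
    refine (hatR_of_commute R (fun c => ?_) φ ψ).symm
    rw [hl]
    refine Prod.ext ?_ ?_ <;> ext <;> simp [actHH, infGG]

/-- For the diagonal actions the quadratic part `-tr(a R a')` of `R̂_M` is exactly the image of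
`-R`; everything else in `P_λ` is invariant. -/
theorem isPoissonAction_actG (hR : IsRMatrix (traceForm V) R) (hρ : IsRMatrix (traceForm W) ρ)
    (c : ℂ) :
    IsPoissonAction (E := Mspace V W) (A := gl V) (sklyanin (A := gl V) (traceForm V) ((-c) • R))
      (bracketOf (c • tensorP R ρ lam)) (actG (V := V) (W := W)) := by
  refine isPoissonAction_of_invariant traceForm_assoc (hR.isMod.smul (-c))
    ((isPoissonField_tensorP R ρ lam hR hρ).smul c) ((leftGG V W).compl₂ (diagonal (gl V)))
    ((rightGG V W).compl₂ (diagonal (gl V))) ?_ ?_ ?_ ?_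
  · intro g m
    simp [actG, diagonal]
  · intro m
    refine Prod.ext ?_ ?_ <;> ext <;> simp [actG]
  · intro g h m
    refine Prod.ext ?_ ?_ <;> ext <;> simp [actG]
  · intro g l hl m φ ψ
    have h (m : Mspace V W) (φ ψ : Module.Dual ℂ (Mspace V W)) :
        (c • tensorP R ρ lam) m φ ψ - pushTensor (traceForm V) ((-c) • R)
          ((leftGG V W).compl₂ (diagonal (gl V)) m - (rightGG V W).compl₂ (diagonal (gl V)) m) φ ψ =
        c * (hatRho ρ m φ ψ + 2 * lam * constPi V W m φ ψ +
          tr V (m.1 ∘L (cotangent V W φ).2 ∘L (cotangent V W ψ).1 ∘L m.2) -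
          tr V ((cotangent V W φ).1 ∘L m.2 ∘L m.1 ∘L (cotangent V W ψ).2)) := by
      have e : (leftGG V W).compl₂ (diagonal (gl V)) m - (rightGG V W).compl₂ (diagonal (gl V)) m =
          infGG m ∘ₗ diagonal (gl V) := by
        rw [← leftGG_sub_rightGG]
        rfl
      rw [e, pushTensor_diagonal_infGG]
      simp only [Pi.smul_apply, LinearMap.smul_apply, smul_eq_mul, tensorP_apply, hatR_apply,
        ContinuousLinearMap.comp_smul, map_smul]
      ring
    have hc (φ : Module.Dual ℂ (Mspace V W)) : cotangent V W (φ ∘ₗ l) =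
        (((g⁻¹ : (gl V)ˣ) : gl V) ∘L (cotangent V W φ).1, (cotangent V W φ).2 ∘L (g : gl V)) := by
      refine cotangent_eq fun n => ?_
      rw [LinearMap.comp_apply, hl, apply_eq_tr]
      rfl
    rw [h, h, hatRho_of_commute ρ (m' := actG g m) (fun d => by
      rw [hl]
      refine Prod.ext ?_ ?_ <;> ext <;> simp [actG, infHH])]
    have hg : ((g⁻¹ : (gl V)ˣ) : gl V) ∘L (g : gl V) = ContinuousLinearMap.id ℂ V := g.inv_mul
    have hg' : (g : gl V) ∘L ((g⁻¹ : (gl V)ˣ) : gl V) = ContinuousLinearMap.id ℂ V := g.mul_inv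
    simp only [constPi_apply, hc, actG, ContinuousLinearMap.comp_assoc, inv_comp_comp,
      comp_inv_comp,
      tr_comm (g : gl V), tr_comm ((g⁻¹ : (gl V)ˣ) : gl V), hg, hg', ContinuousLinearMap.comp_id]

theorem isPoissonAction_actH (hR : IsRMatrix (traceForm V) R) (hρ : IsRMatrix (traceForm W) ρ)
    (c : ℂ) :
    IsPoissonAction (E := Mspace V W) (A := gl W) (sklyanin (A := gl W) (traceForm W) ((-c) • ρ))
      (bracketOf (c • tensorP R ρ lam)) (actH (V := V) (W := W)) := by
  refine isPoissonAction_of_invariant traceForm_assoc (hρ.isMod.smul (-c))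
    ((isPoissonField_tensorP R ρ lam hR hρ).smul c) ((leftHH V W).compl₂ (diagonal (gl W)))
    ((rightHH V W).compl₂ (diagonal (gl W))) ?_ ?_ ?_ ?_
  · intro g m
    simp [actH, diagonal]
  · intro m
    refine Prod.ext ?_ ?_ <;> ext <;> simp [actH]
  · intro g h m
    refine Prod.ext ?_ ?_ <;> ext <;> simp [actH]
  · intro g l hl m φ ψ
    have h (m : Mspace V W) (φ ψ : Module.Dual ℂ (Mspace V W)) :
        (c • tensorP R ρ lam) m φ ψ - pushTensor (traceForm W) ((-c) • ρ)
          ((leftHH V W).compl₂ (diagonal (gl W)) m - (rightHH V W).compl₂ (diagonal (gl W)) m) φ ψ =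
        c * (hatR R m φ ψ + 2 * lam * constPi V W m φ ψ +
          tr W ((cotangent V W φ).2 ∘L m.1 ∘L m.2 ∘L (cotangent V W ψ).1) -
          tr W (m.2 ∘L (cotangent V W φ).1 ∘L (cotangent V W ψ).2 ∘L m.1)) := by
      have e : (leftHH V W).compl₂ (diagonal (gl W)) m - (rightHH V W).compl₂ (diagonal (gl W)) m =
          infHH m ∘ₗ diagonal (gl W) := by
        rw [← leftHH_sub_rightHH]
        rfl
      rw [e, pushTensor_diagonal_infHH]
      simp only [Pi.smul_apply, LinearMap.smul_apply, smul_eq_mul, tensorP_apply, hatRho_apply,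
        ContinuousLinearMap.comp_smul, map_smul]
      ring
    have hc (φ : Module.Dual ℂ (Mspace V W)) : cotangent V W (φ ∘ₗ l) =
        ((cotangent V W φ).1 ∘L (g : gl W), ((g⁻¹ : (gl W)ˣ) : gl W) ∘L (cotangent V W φ).2) := by
      refine cotangent_eq fun n => ?_
      rw [LinearMap.comp_apply, hl, apply_eq_tr]
      simp only [actH, ContinuousLinearMap.comp_assoc, tr_comm (g : gl W),
        tr_comm ((g⁻¹ : (gl W)ˣ) : gl W)]
    rw [h, h, hatR_of_commute R (m' := actH g m) (fun d => by
      rw [hl]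
      refine Prod.ext ?_ ?_ <;> ext <;> simp [actH, infGG])]
    have hg : ((g⁻¹ : (gl W)ˣ) : gl W) ∘L (g : gl W) = ContinuousLinearMap.id ℂ W := g.inv_mul
    have hg' : (g : gl W) ∘L ((g⁻¹ : (gl W)ˣ) : gl W) = ContinuousLinearMap.id ℂ W := g.mul_inv
    simp only [constPi_apply, hc, actH, ContinuousLinearMap.comp_assoc, inv_comp_comp,
      comp_inv_comp,
      tr_comm (g : gl W), tr_comm ((g⁻¹ : (gl W)ˣ) : gl W), hg, hg', ContinuousLinearMap.comp_id]

theorem halfBracket_linFun_right (ξ : W →L[ℂ] V) (x : V →L[ℂ] W) (H : Mspace V W → ℂ)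
    (v : W →L[ℂ] V) (w : V →L[ℂ] W) :
    halfBracket R ρ lam H (linFun ξ x) (v, w) =
      fderiv ℂ H (v, w) (hamV R ρ lam ξ x v w, hamW R ρ lam ξ x v w) := by
  rw [halfBracket, bracketOf, half_tensorP_eq, cotangent_diff_linFun]
  rfl

end Actions

end PoissonGL

end

open PoissonGL in
theorem proposition4 {V W : Type*}
    [NormedAddCommGroup V] [NormedSpace ℂ V] [FiniteDimensional ℂ V]
    [NormedAddCommGroup W] [NormedSpace ℂ W] [FiniteDimensional ℂ W]
    (R : gl V →ₗ[ℂ] gl V) (hR : IsRMatrix (traceForm V) R)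
    (ρ : gl W →ₗ[ℂ] gl W) (hρ : IsRMatrix (traceForm W) ρ) (lam : ℂ) :
    -- the bivector is a Poisson tensor, and so is its half
    IsPoissonTensor (tensorP R ρ lam) ∧
    IsPoissonTensor ((1 / 2 : ℂ) • tensorP R ρ lam) ∧
    -- the half bracket on linear functions
    (∀ (ξ η : W →L[ℂ] V) (x y : V →L[ℂ] W) (v : W →L[ℂ] V) (w : V →L[ℂ] W),
      halfBracket R ρ lam (linFun ξ x) (linFun η y) (v, w) =
        (1 / 2 : ℂ) *
          (-tr V ((v ∘L x - ξ ∘L w) ∘L R (v ∘L y - η ∘L w))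
            - tr W ((x ∘L v - w ∘L ξ) ∘L ρ (y ∘L v - w ∘L η))
            - tr W ((w ∘L v) ∘L (y ∘L ξ - x ∘L η))
            - tr V ((v ∘L w) ∘L (ξ ∘L y - η ∘L x))
            + 2 * lam * tr W (x ∘L η - y ∘L ξ))) ∧
    -- the Hamiltonian vector field of a linear function
    (∀ (ξ : W →L[ℂ] V) (x : V →L[ℂ] W) (H : Mspace V W → ℂ), IsHol (Mspace V W) H →
      ∀ (v : W →L[ℂ] V) (w : V →L[ℂ] W),
      halfBracket R ρ lam H (linFun ξ x) (v, w) =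
        fderiv ℂ H (v, w) (hamV R ρ lam ξ x v w, hamW R ρ lam ξ x v w)) ∧
    -- the actions of `GL(V)` and `GL(W)` are Poisson, for the bivector and for its half
    IsPoissonAction (E := Mspace V W) (A := gl V) (sklyanin (A := gl V) (traceForm V) (-R))
      (fullBracket R ρ lam) (actG (V := V) (W := W)) ∧
    IsPoissonAction (E := Mspace V W) (A := gl W) (sklyanin (A := gl W) (traceForm W) (-ρ))
      (fullBracket R ρ lam) (actH (V := V) (W := W)) ∧
    IsPoissonAction (E := Mspace V W) (A := gl V) (sklyanin (A := gl V) (traceForm V) (-(1 / 2 : ℂ) • R))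
      (halfBracket R ρ lam) (actG (V := V) (W := W)) ∧
    IsPoissonAction (E := Mspace V W) (A := gl W) (sklyanin (A := gl W) (traceForm W) (-(1 / 2 : ℂ) • ρ))
      (halfBracket R ρ lam) (actH (V := V) (W := W)) ∧
    -- for `λ = 0` the actions of the doubles are Poisson
    IsPoissonAction (E := Mspace V W) (A := gl V × gl V)
      (sklyanin (A := gl V × gl V) (doubleForm (traceForm V)) (doubleR R))
      (fullBracket R ρ 0) (actGG (V := V) (W := W)) ∧
    IsPoissonAction (E := Mspace V W) (A := gl W × gl W)
      (sklyanin (A := gl W × gl W) (doubleForm (traceForm W)) (doubleR ρ))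
      (fullBracket R ρ 0) (actHH (V := V) (W := W)) := by
  refine ⟨(isPoissonField_tensorP R ρ lam hR hρ).isPoissonTensor,
    (isPoissonField_half_tensorP R ρ lam hR hρ).isPoissonTensor,
    fun ξ η x y v w => halfBracket_linFun R ρ lam ξ η x y v w,
    fun ξ x H _ v w => halfBracket_linFun_right R ρ lam ξ x H v w,
    ?_, ?_, isPoissonAction_actG R ρ lam hR hρ (1 / 2), isPoissonAction_actH R ρ lam hR hρ (1 / 2),
    isPoissonAction_actGG R ρ hR hρ, isPoissonAction_actHH R ρ hR hρ⟩
  · have h := isPoissonAction_actG R ρ lam hR hρ 1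
    rw [one_smul, show (-1 : ℂ) • R = -R from neg_one_smul ℂ R] at h
    exact h
  · have h := isPoissonAction_actH R ρ lam hR hρ 1
    rw [one_smul, show (-1 : ℂ) • ρ = -ρ from neg_one_smul ℂ ρ] at h
    exact h
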